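/- Let $\ell>0$. Let $H^1_0=H^1_0(0,\pi)$, let $V=H^2\cap H^1_0(0,\pi)$ with the $H^2$ norm, and let $H^{-1}=(H^1_0)'$ and $H^*=V'$ be the dual spaces; $u\in L^2(0,\pi)$ is identified with the functional $\varphi\mapsto(u,\varphi)$ in $H^{-1}$ and in $H^*$, where $(\cdot,\cdot)$ is the scalar product of $L^2(0,\pi)$. Let $\eta_0\in H^2\cap H^1_0(0,\pi)$, $\theta_0\in H^1_0(0,\pi)$ and $\eta_1,\theta_1\in L^2(0,\pi)$. Assume that $f:\mathbb R\to\mathbb R$ is locally Lipschitz and nondecreasing, with $f(0)=0$, and that $|f(s)|\le C(1+|s|^p)$ for every $s\in\mathbb R\setminus\{0\}$, for some constants $C$ and $p\ge 1$. Consider the system $$\begin{cases} y_{tt}+y_{xxxx}+f(y+\ell\sin\theta)+f(y-\ell\sin\theta)=0,\\ \ell\theta_{tt}-\ell\theta_{xx}+3\cos\theta\,\bigl(f(y+\ell\sin\theta)-f(y-\ell\sin\theta)\bigr)=0,\end{cases}\qquad 0<x<\pi,\ t>0,$$ with the boundary conditions $y=y_{xx}=\theta=0$ at $x=0$ and $x=\pi$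 for $t\ge 0$, and the initial conditions $y(\cdot,0)=\eta_0$, $y_t(\cdot,0)=\eta_1$, $\theta(\cdot,0)=\theta_0$, $\theta_t(\cdot,0)=\theta_1$. A solution of this problem is a pair $$y\in C^0([0,\infty);H^2\cap H^1_0(0,\pi))\cap C^1([0,\infty);L^2(0,\pi))\cap C^2([0,\infty);H^*),$$ $$\theta\in C^0([0,\infty);H^1_0(0,\pi))\cap C^1([0,\infty);L^2(0,\pi))\cap C^2([0,\infty);H^{-1})$$ which satisfies the initial conditions and, for every $t>0$, $$\langle y_{tt},\varphi\rangle_{H^*}+(y_{xx},\varphi'')+\bigl(f(y-\ell\sin\theta)+f(y+\ell\sin\theta),\varphi\bigr)=0\qquad\forall\,\varphi\in H^2\cap H^1_0(0,\pi),$$ $$\ell\langle\theta_{tt},\psi\rangle_{H^{-1}}+\ell(\theta_x,\psi')+\bigl(3\cos\theta\,(f(y+\ell\sin\theta)-f(y-\ell\sin\theta)),\psi\bigr)=0\qquad\forall\,\psi\in H^1_0(0,\pi).$$ Then there exists a unique solution $(y,\theta)$ of this problem. -/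

import Mathlib

open MeasureTheory Set
open scoped ContDiff

noncomputable section

namespace FishBone

/-- Lebesgue measure on the interval `(0, π)`. -/
abbrev μI : Measure ℝ := volume.restrict (Ioo (0 : ℝ) Real.pi)

/-- The real Hilbert space `L²(0, π)`. -/
abbrev L2 : Type := Lp ℝ 2 μI

/-- `φ ∈ C_c^∞(0, π)`, seen as a function on the whole line (extended by zero). -/
structure IsTest (φ : ℝ → ℝ) : Prop where
  smooth : ContDiff ℝ ∞ φ
  compact : HasCompactSupport φ
  supp : tsupport φ ⊆ Ioo (0 : ℝ) Real.pi

/-- `v ∈ L²(0, π)` is the weak derivative of `u ∈ L²(0, π)`. -/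
def IsWeakDeriv (u v : L2) : Prop :=
  ∀ φ : ℝ → ℝ, IsTest φ → ∫ x, u x * deriv φ x ∂μI = - ∫ x, v x * φ x ∂μI

theorem integrable_mul (u : L2) {g : ℝ → ℝ} (hg : Continuous g) (hc : HasCompactSupport g) :
    Integrable (fun x => u x * g x) μI :=
  MemLp.integrable_mul (p := 2) (q := 2) (Lp.memLp u) (hg.memLp_of_hasCompactSupport hc)

theorem IsTest.integrable_mul {φ : ℝ → ℝ} (h : IsTest φ) (u : L2) :
    Integrable (fun x => u x * φ x) μI :=
  FishBone.integrable_mul u h.smooth.continuous h.compact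

theorem IsTest.integrable_mul_deriv {φ : ℝ → ℝ} (h : IsTest φ) (u : L2) :
    Integrable (fun x => u x * deriv φ x) μI :=
  FishBone.integrable_mul u (h.smooth.continuous_deriv (by simp)) h.compact.deriv

theorem integral_add_mul (u v : L2) {g : ℝ → ℝ} (hu : Integrable (fun x => u x * g x) μI)
    (hv : Integrable (fun x => v x * g x) μI) :
    ∫ x, (u + v : L2) x * g x ∂μI = ∫ x, u x * g x ∂μI + ∫ x, v x * g x ∂μI := by
  rw [← integral_add hu hv]
  refine integral_congr_ae ?_
  filter_upwards [Lp.coeFn_add u v] with x hx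
  rw [hx, Pi.add_apply, add_mul]

theorem integral_smul_mul (c : ℝ) (u : L2) (g : ℝ → ℝ) :
    ∫ x, (c • u : L2) x * g x ∂μI = c * ∫ x, u x * g x ∂μI := by
  rw [← integral_const_mul]
  refine integral_congr_ae ?_
  filter_upwards [Lp.coeFn_smul c u] with x hx
  rw [hx, Pi.smul_apply, smul_eq_mul, mul_assoc]

theorem IsWeakDeriv.zero : IsWeakDeriv 0 0 := by
  intro φ _
  have h := integral_smul_mul 0 0
  simp only [zero_smul, zero_mul] at h
  rw [h, h, neg_zero]

theorem IsWeakDeriv.add {u v u' v' : L2} (h : IsWeakDeriv u v) (h' : IsWeakDeriv u' v') :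
    IsWeakDeriv (u + u') (v + v') := by
  intro φ hφ
  rw [integral_add_mul _ _ (hφ.integrable_mul_deriv u) (hφ.integrable_mul_deriv u'),
    integral_add_mul _ _ (hφ.integrable_mul v) (hφ.integrable_mul v'), h φ hφ, h' φ hφ]
  ring

theorem IsWeakDeriv.smul {u v : L2} (c : ℝ) (h : IsWeakDeriv u v) :
    IsWeakDeriv (c • u) (c • v) := by
  intro φ hφ
  rw [integral_smul_mul, integral_smul_mul, h φ hφ]
  ring

/-- The Sobolev space `H¹(0, π)`: the pairs `(u, u')` of an `L²` function and its `L²` weak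
derivative, with the norm `(‖u‖₂² + ‖u'‖₂²)^(1/2)`. -/
def H1 : Submodule ℝ (WithLp 2 (L2 × L2)) where
  carrier := {w | IsWeakDeriv w.fst w.snd}
  zero_mem' := IsWeakDeriv.zero
  add_mem' := fun h h' => IsWeakDeriv.add h h'
  smul_mem' := fun c _ h => IsWeakDeriv.smul c h

/-- The Sobolev space `H¹₀(0, π)`: the closure of `C_c^∞(0, π)` in `H¹(0, π)`. Its elements are
again pairs `(u, u')`, with the `H¹` norm. -/
def H10 : Submodule ℝ (WithLp 2 (L2 × L2)) :=
  (Submodule.span ℝ {w : H1 | ∃ φ : ℝ → ℝ, IsTest φ ∧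
    w.1.fst =ᵐ[μI] φ ∧ w.1.snd =ᵐ[μI] deriv φ}).topologicalClosure.map H1.subtype

/-- The inclusion `H¹₀(0, π) → L²(0, π)`. -/
def H10.toL2 : H10 →L[ℝ] L2 := (WithLp.fstL 2 ℝ L2 L2).comp H10.subtypeL

/-- The weak derivative `u ↦ u'`, from `H¹₀(0, π)` to `L²(0, π)`. -/
def H10.dx : H10 →L[ℝ] L2 := (WithLp.sndL 2 ℝ L2 L2).comp H10.subtypeL

/-- The space `H² ∩ H¹₀(0, π)`: the triples `((u, u'), u'')` with `(u, u')` in `H¹₀(0, π)` and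
`u'' ∈ L²(0, π)` the weak derivative of `u'`, with the `H²` norm
`(‖u‖₂² + ‖u'‖₂² + ‖u''‖₂²)^(1/2)`. -/
def H2H10 : Submodule ℝ (WithLp 2 (WithLp 2 (L2 × L2) × L2)) where
  carrier := {w | w.fst ∈ H10 ∧ IsWeakDeriv w.fst.snd w.snd}
  zero_mem' := ⟨H10.zero_mem, IsWeakDeriv.zero⟩
  add_mem' := fun h h' => ⟨H10.add_mem h.1 h'.1, IsWeakDeriv.add h.2 h'.2⟩
  smul_mem' := fun c _ h => ⟨H10.smul_mem c h.1, IsWeakDeriv.smul c h.2⟩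

/-- The inclusion `H² ∩ H¹₀(0, π) → L²(0, π)`. -/
def H2H10.toL2 : H2H10 →L[ℝ] L2 :=
  (WithLp.fstL 2 ℝ L2 L2).comp ((WithLp.fstL 2 ℝ (WithLp 2 (L2 × L2)) L2).comp H2H10.subtypeL)

/-- The second weak derivative `u ↦ u''`, from `H² ∩ H¹₀(0, π)` to `L²(0, π)`. -/
def H2H10.dxx : H2H10 →L[ℝ] L2 :=
  (WithLp.sndL 2 ℝ (WithLp 2 (L2 × L2)) L2).comp H2H10.subtypeL

/-- The embedding of `L²(0, π)` in the dual `H⁻¹` of `H¹₀(0, π)`: `⟨u, ψ⟩ = (u, ψ)`. -/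
def toHneg1 (u : L2) : StrongDual ℝ H10 := (innerSL ℝ u).comp H10.toL2

/-- The embedding of `L²(0, π)` in the dual `H*` of `H² ∩ H¹₀(0, π)`: `⟨u, φ⟩ = (u, φ)`. -/
def toHstar (u : L2) : StrongDual ℝ H2H10 := (innerSL ℝ u).comp H2H10.toL2

/-- `(y, θ)` is a (weak) solution of the fish-bone system on `[0, ∞)` with initial data
`η₀, η₁, θ₀, θ₁`. Only the values of `y` and `θ` on `[0, ∞)` matter; at `t = 0` the time
derivatives are one-sided. -/
structure IsSolution (ℓ : ℝ) (f : ℝ → ℝ) (η₀ : H2H10) (η₁ : L2) (θ₀ : H10) (θ₁ : L2)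
    (y : ℝ → H2H10) (θ : ℝ → H10) : Prop where
  y_C0 : ContinuousOn y (Ici 0)
  y_C1 : ContDiffOn ℝ 1 (fun t => H2H10.toL2 (y t)) (Ici 0)
  y_C2 : ContDiffOn ℝ 2 (fun t => toHstar (H2H10.toL2 (y t))) (Ici 0)
  θ_C0 : ContinuousOn θ (Ici 0)
  θ_C1 : ContDiffOn ℝ 1 (fun t => H10.toL2 (θ t)) (Ici 0)
  θ_C2 : ContDiffOn ℝ 2 (fun t => toHneg1 (H10.toL2 (θ t))) (Ici 0)
  y_init : y 0 = η₀
  yt_init : derivWithin (fun t => H2H10.toL2 (y t)) (Ici 0) 0 = η₁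
  θ_init : θ 0 = θ₀
  θt_init : derivWithin (fun t => H10.toL2 (θ t)) (Ici 0) 0 = θ₁
  eq_y : ∀ t : ℝ, 0 < t → ∀ φ : H2H10,
    iteratedDerivWithin 2 (fun s => toHstar (H2H10.toL2 (y s))) (Ici 0) t φ
      + inner ℝ (H2H10.dxx (y t)) (H2H10.dxx φ)
      + ∫ x, (f (H2H10.toL2 (y t) x - ℓ * Real.sin (H10.toL2 (θ t) x))
          + f (H2H10.toL2 (y t) x + ℓ * Real.sin (H10.toL2 (θ t) x)))
          * H2H10.toL2 φ x ∂μI = 0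
  eq_θ : ∀ t : ℝ, 0 < t → ∀ ψ : H10,
    ℓ * iteratedDerivWithin 2 (fun s => toHneg1 (H10.toL2 (θ s))) (Ici 0) t ψ
      + ℓ * inner ℝ (H10.dx (θ t)) (H10.dx ψ)
      + ∫ x, 3 * Real.cos (H10.toL2 (θ t) x)
          * (f (H2H10.toL2 (y t) x + ℓ * Real.sin (H10.toL2 (θ t) x))
            - f (H2H10.toL2 (y t) x - ℓ * Real.sin (H10.toL2 (θ t) x)))
          * H10.toL2 ψ x ∂μI = 0

end FishBone

end

/-!
# Well-posedness of the fish-bone system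

The linear part is diagonal in the Hilbert basis of `L²(0, π)` made of the sines `sin((n+1)x)`
(`sineBasis`). With `Λ` the Dirichlet Laplacian for `y` and its square root for `θ`, both equations
read `u_tt + Λ² u + g = 0`, and `H² ∩ H¹₀(0, π)` and `H¹₀(0, π)` are the domains of the respective
`Λ` (`Realization`, `realizationH2H10`, `realizationH10`).

In the interaction picture, i.e. for the state `(Λ u, u_t)` transported back to time `0` by the
free evolution (a rotation of angle `(n+1)² t` or `(n+1) t` of the `n`-th coordinates), the unbounded
operators disappear: the system becomes an ordinary differential equation in `(L² × L²)²` whose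
right-hand side only involves bounded operators and the superposition operators of the
nonlinearities (`vectorField`).

If `f` is replaced by the function equal to `f` on `[-R, R]` and constant beyond
(`truncate`), the nonlinearities are bounded and globally Lipschitz in `L²`, and the equation has a
global solution by the Picard-Lindelöf theorem (`exists_integralCurve_vectorField`). The energy,
with the potential `∫ F(y + ℓ sin θ) + F(y - ℓ sin θ)`, `F` the primitive of `f`, is conserved
(`energy_eq`) and `F ≥ 0`, so that `y` is bounded in `H²`, hence in `L^∞`
(`ae_abs_le_of_mem_H10`), by a constant that depends only on the initial data. For `R` large the
truncation is therefore inactive, and `exists_solution` follows.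

Conversely, a weak solution tested against the sines satisfies the equations of the interaction
picture coordinate by coordinate (`Realization.kick_of_weak_solution`). As the right-hand side is
continuous in `L²`, the coordinatewise equation is an equation in `L²`
(`hasDerivWithinAt_of_coord`). On `[0, T]` two solutions are bounded, both solve the same truncated
equation, and they agree by Grönwall's inequality (`IsSolution.unique`).
-/

noncomputable section

namespace FishBone

/-! ### Diagonal operators in a Hilbert basis, and differentiation by coordinates -/

section Diagonal

variable {H : Type*} [NormedAddCommGroup H] [InnerProductSpace ℝ H] (e : HilbertBasis ℕ ℝ H)

theorem ext_coord {x y : H} (h : ∀ n, inner ℝ (e n) x = inner ℝ (e n) y) : x = y := by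
  apply e.repr.injective
  ext n
  rw [e.repr_apply_apply, e.repr_apply_apply, h n]

/-- The operator that multiplies the `n`-th coordinate in the Hilbert basis `e` by `m n`, for a
sequence `m` with values in `[-1, 1]`. -/
def diag (m : ℕ → ℝ) (hm : ∀ n, |m n| ≤ 1) : H →L[ℝ] H :=
  have key (x : H) (n : ℕ) : ‖m n * e.repr x n‖ ≤ ‖e.repr x n‖ := by
    rw [norm_mul]
    exact mul_le_of_le_one_left (norm_nonneg _) (hm n)
  LinearMap.mkContinuous
    { toFun := fun x => e.repr.symm
        ⟨fun n => m n * e.repr x n, (lp.memℓp (e.repr x)).mono' (key x)⟩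
      map_add' := fun x y => by
        rw [← map_add]
        congr 1
        ext n
        rw [lp.coeFn_add, Pi.add_apply]
        simp only [map_add, lp.coeFn_add, Pi.add_apply]
        ring
      map_smul' := fun c x => by
        rw [← map_smul]
        congr 1
        ext n
        simp only [map_smul, lp.coeFn_smul, Pi.smul_apply, smul_eq_mul, RingHom.id_apply]
        ring } 1 (fun x => by
      rw [one_mul, ← e.repr.norm_map x, LinearMap.coe_mk, AddHom.coe_mk,
        LinearIsometryEquiv.norm_map]
      exact lp.norm_mono two_ne_zero (key x))

variable {m : ℕ → ℝ} (hm : ∀ n, |m n| ≤ 1)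

@[simp]
theorem inner_diag (n : ℕ) (x : H) :
    inner ℝ (e n) (diag e m hm x) = m n * inner ℝ (e n) x := by
  rw [← e.repr_apply_apply, ← e.repr_apply_apply]
  simp [diag]

theorem norm_diag_apply_le (x : H) : ‖diag e m hm x‖ ≤ ‖x‖ := by
  rw [← e.repr.norm_map, ← e.repr.norm_map x]
  refine lp.norm_mono two_ne_zero fun n => ?_
  rw [e.repr_apply_apply, e.repr_apply_apply, inner_diag, norm_mul]
  exact mul_le_of_le_one_left (norm_nonneg _) (hm n)

theorem hasSum_coord_mul (x y : H) :
    HasSum (fun n => inner ℝ (e n) x * inner ℝ (e n) y) (inner ℝ x y) := by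
  simpa only [real_inner_comm x] using e.hasSum_inner_mul_inner x y

theorem inner_diag_left (x y : H) :
    inner ℝ (diag e m hm x) y = inner ℝ x (diag e m hm y) := by
  refine (hasSum_coord_mul e _ _).unique ?_
  convert hasSum_coord_mul e x (diag e m hm y) using 2 with n
  simp only [inner_diag]
  ring

theorem continuous_diag_apply {m : ℝ → ℕ → ℝ} (hm : ∀ t n, |m t n| ≤ 1)
    (hc : ∀ n, Continuous fun t => m t n) (x : H) :
    Continuous fun t => diag e (m t) (hm t) x := by
  rw [continuous_iff_continuousAt]
  intro s
  rw [ContinuousAt, tendsto_iff_norm_sub_tendsto_zero]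
  have hsq : ∀ t, ‖diag e (m t) (hm t) x - diag e (m s) (hm s) x‖ ^ 2
      = ∑' n, (m t n - m s n) ^ 2 * inner ℝ (e n) x ^ 2 := by
    intro t
    rw [← real_inner_self_eq_norm_sq, ← (hasSum_coord_mul e _ _).tsum_eq]
    refine tsum_congr fun n => ?_
    simp only [inner_sub_right, inner_diag]
    ring
  have hlim : Filter.Tendsto (fun t => ∑' n, (m t n - m s n) ^ 2 * inner ℝ (e n) x ^ 2)
      (nhds s) (nhds (∑' _ : ℕ, 0)) := by
    refine tendsto_tsum_of_dominated_convergence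
      (bound := fun n => 4 * (inner ℝ (e n) x * inner ℝ (e n) x))
      ((hasSum_coord_mul e x x).summable.mul_left 4) (fun n => ?_)
      (Filter.Eventually.of_forall fun t n => ?_)
    · have : ContinuousAt (fun t => (m t n - m s n) ^ 2 * inner ℝ (e n) x ^ 2) s := by
        have := (hc n).continuousAt (x := s)
        fun_prop
      simpa [ContinuousAt] using this
    · have h1 := abs_le.1 (hm t n)
      have h2 := abs_le.1 (hm s n)
      have h3 : (m t n - m s n) ^ 2 ≤ 4 := by nlinarith
      rw [Real.norm_of_nonneg (by positivity)]
      nlinarith [sq_nonneg (inner ℝ (e n) x)]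
  rw [tsum_zero] at hlim
  have h := (hlim.congr fun t => (hsq t).symm).sqrt
  simpa [Real.sqrt_sq] using h

/-- Joint continuity of a strongly continuous family of contractions along a continuous curve. -/
theorem continuous_diag_comp {m : ℝ → ℕ → ℝ} (hm : ∀ t n, |m t n| ≤ 1)
    (hc : ∀ n, Continuous fun t => m t n) {S : Set ℝ} {γ : ℝ → H} (hγ : ContinuousOn γ S) :
    ContinuousOn (fun t => diag e (m t) (hm t) (γ t)) S := by
  intro s hs
  have h1 : Filter.Tendsto (fun t => diag e (m t) (hm t) (γ s)) (nhdsWithin s S)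
      (nhds (diag e (m s) (hm s) (γ s))) :=
    ((continuous_diag_apply e hm hc (γ s)).tendsto s).mono_left nhdsWithin_le_nhds
  have h2 : Filter.Tendsto (fun t => diag e (m t) (hm t) (γ t - γ s)) (nhdsWithin s S)
      (nhds 0) := by
    refine squeeze_zero_norm (fun t => norm_diag_apply_le e (hm t) _) ?_
    exact tendsto_iff_norm_sub_tendsto_zero.1 (hγ s hs)
  have h3 := h1.add h2
  simp only [map_sub, add_sub_cancel, add_zero] at h3
  exact h3

variable [CompleteSpace H]

theorem inner_intervalIntegral (n : ℕ) {v : ℝ → H} (hv : Continuous v) (t : ℝ) :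
    inner ℝ (e n) (∫ s in (0 : ℝ)..t, v s) = ∫ s in (0 : ℝ)..t, inner ℝ (e n) (v s) :=
  ((innerSL ℝ (e n)).intervalIntegral_comp_comm (hv.intervalIntegrable 0 t)).symm

/-- A curve whose coordinates are differentiable is differentiable, as soon as the coordinates of
its derivative are those of a continuous curve. -/
theorem hasDerivAt_of_coord {γ v : ℝ → H} (hv : Continuous v)
    (h : ∀ n t, HasDerivAt (fun s => inner ℝ (e n) (γ s)) (inner ℝ (e n) (v t)) t) (t : ℝ) :
    HasDerivAt γ (v t) t := by
  have hγ : γ = fun t => γ 0 + ∫ s in (0 : ℝ)..t, v s := by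
    funext t
    refine ext_coord e fun n => ?_
    rw [inner_add_right, inner_intervalIntegral e n hv,
      intervalIntegral.integral_eq_sub_of_hasDerivAt (fun s _ => h n s)
        (Continuous.intervalIntegrable (by fun_prop) _ _)]
    ring
  rw [hγ]
  exact (intervalIntegral.integral_hasDerivAt_right (hv.intervalIntegrable 0 t)
    (hv.stronglyMeasurableAtFilter _ _) hv.continuousAt).const_add _

/-- The version of `hasDerivAt_of_coord` on an interval `[0, T)`, with derivatives from the right:
nothing is asked of the coordinates at `0` but continuity. -/
theorem hasDerivWithinAt_of_coord {γ v : ℝ → H} (hv : ContinuousOn v (Ici 0))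
    (hc : ∀ n, ContinuousOn (fun s => inner ℝ (e n) (γ s)) (Ici 0)) {T : ℝ}
    (h : ∀ n, ∀ t ∈ Ioo 0 T,
      HasDerivAt (fun s => inner ℝ (e n) (γ s)) (inner ℝ (e n) (v t)) t)
    {t : ℝ} (ht : t ∈ Ico 0 T) : HasDerivWithinAt γ (v t) (Ici t) t := by
  -- `v'` extends `v` to a continuous curve on the whole line
  set v' : ℝ → H := fun s => v (max s 0) with hv'_def
  have hv' : Continuous v' :=
    hv.comp_continuous (by fun_prop) fun s => mem_Ici.2 (le_max_right s 0)
  have hvv' : ∀ s, 0 ≤ s → v' s = v s := fun s hs => by simp [hv'_def, max_eq_left hs]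
  have hγ : ∀ t ∈ Ico 0 T, γ t = γ 0 + ∫ s in (0 : ℝ)..t, v' s := by
    intro t ht
    refine ext_coord e fun n => ?_
    rw [inner_add_right, inner_intervalIntegral e n hv',
      intervalIntegral.integral_eq_sub_of_hasDerivAt_of_le ht.1
        ((hc n).mono Icc_subset_Ici_self)
        (fun s hs => by rw [hvv' s hs.1.le]; exact h n s ⟨hs.1, hs.2.trans ht.2⟩)
        (Continuous.intervalIntegrable (by fun_prop) _ _)]
    ring
  have := (intervalIntegral.integral_hasDerivAt_right (hv'.intervalIntegrable 0 t)
    (hv'.stronglyMeasurableAtFilter _ _) hv'.continuousAt).const_add (γ 0)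
  rw [← hvv' t ht.1]
  refine this.hasDerivWithinAt.congr_of_eventuallyEq ?_ (hγ t ht)
  filter_upwards [Ico_mem_nhdsGE ht.2] with s hs
  exact hγ s ⟨ht.1.trans hs.1, hs.2⟩

end Diagonal

/-! ### Global integral curves -/

section ODE

open scoped NNReal

variable {E : Type*} [NormedAddCommGroup E] [NormedSpace ℝ E] [CompleteSpace E]

/-- A bounded, globally Lipschitz vector field has a global integral curve. -/
theorem exists_global_integralCurve (F : ℝ → E → E) (K M : ℝ≥0) (hK : ∀ t, LipschitzWith K (F t))
    (hc : ∀ x, Continuous fun t => F t x) (hM : ∀ t x, ‖F t x‖ ≤ M) (x₀ : E) :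
    ∃ w : ℝ → E, w 0 = x₀ ∧ ∀ t, HasDerivAt w (F t (w t)) t := by
  have hloc : ∀ n : ℕ, ∃ α : ℝ → E, α 0 = x₀ ∧
      ∀ t ∈ Ioo (-(n + 1 : ℝ)) (n + 1), HasDerivAt α (F t (α t)) t := by
    intro n
    have h0 : (0 : ℝ) ∈ Icc (-(n + 1 : ℝ)) (n + 1) := ⟨by linarith [n.cast_nonneg (α := ℝ)],
      by positivity⟩
    have hPL : IsPicardLindelof F (⟨0, h0⟩ : Icc (-(n + 1 : ℝ)) (n + 1)) x₀ (M * (n + 1)) 0 M K :=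
      { lipschitzOnWith := fun t _ => (hK t).lipschitzOnWith
        continuousOn := fun x _ => (hc x).continuousOn
        norm_le := fun t _ x _ => hM t x
        mul_max_le := by simp }
    obtain ⟨α, hα0, hα⟩ := hPL.exists_eq_forall_mem_Icc_hasDerivWithinAt₀
    exact ⟨α, hα0, fun t ht =>
      (hα t (Ioo_subset_Icc_self ht)).hasDerivAt (Icc_mem_nhds ht.1 ht.2)⟩
  choose α hα0 hα using hloc
  have huniq : ∀ n k : ℕ, n ≤ k → EqOn (α n) (α k) (Ioo (-(n + 1 : ℝ)) (n + 1)) := by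
    intro n k hnk
    have hnk' : (n : ℝ) ≤ k := by exact_mod_cast hnk
    refine ODE_solution_unique_of_mem_Ioo (v := F) (K := K) (s := fun _ => univ) (t₀ := 0)
      (fun t _ => (hK t).lipschitzOnWith) ⟨by linarith [n.cast_nonneg (α := ℝ)], by positivity⟩
      (fun t ht => ⟨hα n t ht, trivial⟩)
      (fun t ht => ⟨hα k t ⟨by linarith [ht.1], by linarith [ht.2]⟩, trivial⟩) ?_
    rw [hα0, hα0]
  refine ⟨fun t => α ⌈|t|⌉₊ t, by simp [hα0], fun t => ?_⟩
  have ht : t ∈ Ioo (-(⌈|t|⌉₊ + 1 : ℝ)) (⌈|t|⌉₊ + 1) :=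
    abs_lt.1 ((Nat.le_ceil |t|).trans_lt (lt_add_one _))
  refine (hα _ t ht).congr_of_eventuallyEq ?_
  filter_upwards [Ioo_mem_nhds ht.1 ht.2] with s hs
  rcases le_total ⌈|s|⌉₊ ⌈|t|⌉₊ with hle | hle
  · exact huniq _ _ hle (abs_lt.1 ((Nat.le_ceil |s|).trans_lt (lt_add_one _)))
  · exact (huniq _ _ hle hs).symm

end ODE

/-! ### Continuous functions as elements of `L²(0, π)` -/

section Continuous

theorem memLp_of_continuous {g : ℝ → ℝ} (hg : Continuous g) : MemLp g 2 μI := by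
  obtain ⟨C, hC⟩ := (isCompact_Icc (a := (0 : ℝ)) (b := Real.pi)).exists_bound_of_continuousOn
    hg.continuousOn
  refine MemLp.of_bound hg.aestronglyMeasurable C ?_
  filter_upwards [ae_restrict_mem measurableSet_Ioo] with x hx
  exact hC x (Ioo_subset_Icc_self hx)

/-- The class in `L²(0, π)` of a continuous function on the line. -/
def ofCont (g : ℝ → ℝ) (hg : Continuous g) : L2 := (memLp_of_continuous hg).toLp g

theorem coeFn_ofCont (g : ℝ → ℝ) (hg : Continuous g) : ofCont g hg =ᵐ[μI] g :=
  MemLp.coeFn_toLp _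

theorem inner_eq_integral (u v : L2) : inner ℝ u v = ∫ x, u x * v x ∂μI := by
  rw [L2.inner_def]
  simp only [RCLike.inner_apply, conj_trivial]
  exact integral_congr_ae (Filter.Eventually.of_forall fun x => mul_comm _ _)

theorem inner_eq_integral_of_ae (u v : L2) {g : ℝ → ℝ} (h : v =ᵐ[μI] g) :
    inner ℝ u v = ∫ x, u x * g x ∂μI := by
  rw [inner_eq_integral]
  refine integral_congr_ae ?_
  filter_upwards [h] with x hx
  rw [hx]

theorem inner_ofCont (u : L2) (g : ℝ → ℝ) (hg : Continuous g) :
    inner ℝ u (ofCont g hg) = ∫ x, u x * g x ∂μI :=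
  inner_eq_integral_of_ae _ _ (coeFn_ofCont g hg)

theorem integral_μI (g : ℝ → ℝ) : ∫ x, g x ∂μI = ∫ x in (0 : ℝ)..Real.pi, g x := by
  rw [intervalIntegral.integral_of_le Real.pi_pos.le, integral_Ioc_eq_integral_Ioo]

theorem inner_ofCont_ofCont (f g : ℝ → ℝ) (hf : Continuous f) (hg : Continuous g) :
    inner ℝ (ofCont f hf) (ofCont g hg) = ∫ x in (0 : ℝ)..Real.pi, f x * g x := by
  rw [inner_ofCont, ← integral_μI]
  refine integral_congr_ae ?_
  filter_upwards [coeFn_ofCont f hf] with x hx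
  rw [hx]

/-- Dominated convergence for continuous functions tested against an element of `L²(0, π)`. -/
theorem tendsto_inner_ofCont (b : L2) {F : ℕ → ℝ → ℝ} (hF : ∀ k, Continuous (F k)) {G : ℝ → ℝ}
    (hG : Continuous G) (C : ℝ) (hC : ∀ k, ∀ x ∈ Ioo 0 Real.pi, |F k x| ≤ C)
    (hlim : ∀ x ∈ Ioo 0 Real.pi, ∀ᶠ k in Filter.atTop, F k x = G x) :
    Filter.Tendsto (fun k => inner ℝ b (ofCont (F k) (hF k))) Filter.atTop
      (nhds (inner ℝ b (ofCont G hG))) := by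
  simp only [inner_ofCont]
  have hb : Integrable (fun x => b x) μI := (Lp.memLp b).integrable (by norm_num)
  refine tendsto_integral_of_dominated_convergence (fun x => C * |b x|) (fun k => ?_)
    (hb.abs.const_mul C) (fun k => ?_) ?_
  · exact hb.aestronglyMeasurable.mul (hF k).aestronglyMeasurable
  · filter_upwards [ae_restrict_mem measurableSet_Ioo] with x hx
    rw [Real.norm_eq_abs, abs_mul, mul_comm]
    exact mul_le_mul_of_nonneg_right (hC k x hx) (abs_nonneg _)
  · filter_upwards [ae_restrict_mem measurableSet_Ioo] with x hx
    refine tendsto_const_nhds.congr' ?_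
    filter_upwards [hlim x hx] with k hk
    rw [hk]

/-- A function of `L²(0, π)` orthogonal to all test functions vanishes. -/
theorem eq_zero_of_integral_test {u : L2} (h : ∀ φ, IsTest φ → ∫ x, u x * φ x ∂μI = 0) :
    u = 0 := by
  rw [Lp.eq_zero_iff_ae_eq_zero]
  have hint : IntegrableOn (fun x => u x) (Ioo 0 Real.pi) := (Lp.memLp u).integrable (by norm_num)
  have := isOpen_Ioo.ae_eq_zero_of_integral_contDiff_smul_eq_zero hint.locallyIntegrableOn
    (fun g hg hc hs => by
      rw [← h g ⟨hg, hc, hs⟩, ← setIntegral_eq_integral_of_forall_compl_eq_zero (s := Ioo 0 Real.pi)]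
      · exact integral_congr_ae (Filter.Eventually.of_forall fun x => mul_comm _ _)
      · intro x hx
        rw [image_eq_zero_of_notMem_tsupport fun h' => hx (hs h'), zero_smul])
  exact (ae_restrict_iff' measurableSet_Ioo).2 this

end Continuous

/-! ### The Hilbert basis of sines -/

section Basis

theorem sqrt_two_div_pi_sq : √(2 / Real.pi) * √(2 / Real.pi) = 2 / Real.pi :=
  Real.mul_self_sqrt (by positivity)

/-- The normalized sines `√(2/π) sin((n+1)x)`. -/
def sineL (n : ℕ) : L2 :=
  ofCont (fun x => √(2 / Real.pi) * Real.sin ((n + 1) * x)) (by fun_prop)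

/-- The normalized cosines `√(2/π) cos((n+1)x)`. -/
def cosineL (n : ℕ) : L2 :=
  ofCont (fun x => √(2 / Real.pi) * Real.cos ((n + 1) * x)) (by fun_prop)

theorem integral_cos_int (m : ℤ) :
    ∫ x in (0 : ℝ)..Real.pi, Real.cos (m * x) = if m = 0 then Real.pi else 0 := by
  split_ifs with h
  · simp [h]
  · have hm : (m : ℝ) ≠ 0 := by exact_mod_cast h
    rw [intervalIntegral.integral_comp_mul_left (fun x => Real.cos x) hm, integral_cos]
    simp [Real.sin_int_mul_pi]

theorem integral_cos_sub_and_add (j k : ℕ) :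
    (∫ x in (0 : ℝ)..Real.pi, Real.cos (((j + 1 : ℝ) - (k + 1)) * x)
      = if j = k then Real.pi else 0) ∧
    ∫ x in (0 : ℝ)..Real.pi, Real.cos (((j + 1 : ℝ) + (k + 1)) * x) = 0 := by
  have h1 := integral_cos_int ((j : ℤ) - k)
  have h2 := integral_cos_int ((j : ℤ) + 1 + (k + 1))
  rw [if_neg (by omega)] at h2
  push_cast at h1 h2
  refine ⟨?_, h2⟩
  rw [add_sub_add_right_eq_sub, h1]
  congr 1
  rw [sub_eq_zero, Nat.cast_inj]

theorem orthonormal_sineL : Orthonormal ℝ sineL := by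
  rw [orthonormal_iff_ite]
  intro j k
  obtain ⟨h1, h2⟩ := integral_cos_sub_and_add j k
  have h : ∀ x : ℝ, √(2 / Real.pi) * Real.sin ((j + 1) * x) *
      (√(2 / Real.pi) * Real.sin ((k + 1) * x))
      = 1 / Real.pi * (Real.cos (((j + 1 : ℝ) - (k + 1)) * x)
        - Real.cos (((j + 1 : ℝ) + (k + 1)) * x)) := by
    intro x
    rw [mul_mul_mul_comm, sqrt_two_div_pi_sq, sub_mul (j + 1 : ℝ), add_mul (j + 1 : ℝ) (k + 1),
      Real.cos_sub, Real.cos_add]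
    ring
  rw [sineL, sineL, inner_ofCont_ofCont]
  simp only [h]
  rw [intervalIntegral.integral_const_mul, intervalIntegral.integral_sub
    (Continuous.intervalIntegrable (by fun_prop) _ _)
    (Continuous.intervalIntegrable (by fun_prop) _ _), h1, h2]
  split_ifs <;> simp

theorem orthonormal_cosineL : Orthonormal ℝ cosineL := by
  rw [orthonormal_iff_ite]
  intro j k
  obtain ⟨h1, h2⟩ := integral_cos_sub_and_add j k
  have h : ∀ x : ℝ, √(2 / Real.pi) * Real.cos ((j + 1) * x) *
      (√(2 / Real.pi) * Real.cos ((k + 1) * x))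
      = 1 / Real.pi * (Real.cos (((j + 1 : ℝ) - (k + 1)) * x)
        + Real.cos (((j + 1 : ℝ) + (k + 1)) * x)) := by
    intro x
    rw [mul_mul_mul_comm, sqrt_two_div_pi_sq, sub_mul (j + 1 : ℝ), add_mul (j + 1 : ℝ) (k + 1),
      Real.cos_sub, Real.cos_add]
    ring
  rw [cosineL, cosineL, inner_ofCont_ofCont]
  simp only [h]
  rw [intervalIntegral.integral_const_mul, intervalIntegral.integral_add
    (Continuous.intervalIntegrable (by fun_prop) _ _)
    (Continuous.intervalIntegrable (by fun_prop) _ _), h1, h2]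
  split_ifs <;> simp

/-- If `u` is orthogonal to all sines then `u sin` is orthogonal to all powers of the cosine, as
`2 sin(mx) cos x = sin((m+1)x) + sin((m-1)x)`. -/
theorem integral_sin_mul_cos_pow {u : L2}
    (h : ∀ n : ℕ, ∫ x, u x * Real.sin ((n + 1 : ℕ) * x) ∂μI = 0) (j n : ℕ) :
    ∫ x, u x * (Real.sin (n * x) * Real.cos x ^ j) ∂μI = 0 := by
  have hint : ∀ g : ℝ → ℝ, Continuous g → Integrable (fun x => u x * g x) μI := fun g hg =>
    MemLp.integrable_mul (p := 2) (q := 2) (Lp.memLp u) (memLp_of_continuous hg)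
  induction j generalizing n with
  | zero =>
    cases n with
    | zero => simp
    | succ n => simpa using h n
  | succ j ih =>
    cases n with
    | zero => simp
    | succ n =>
      have e : ∀ x, u x * (Real.sin ((n + 1 : ℕ) * x) * Real.cos x ^ (j + 1))
          = (u x * (Real.sin ((n + 2 : ℕ) * x) * Real.cos x ^ j)
            + u x * (Real.sin (n * x) * Real.cos x ^ j)) / 2 := by
        intro x
        have h1 : ((n + 2 : ℕ) : ℝ) * x = (n + 1 : ℕ) * x + x := by push_cast; ring
        have h2 : (n : ℝ) * x = (n + 1 : ℕ) * x - x := by push_cast; ring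
        rw [h1, h2, Real.sin_add, Real.sin_sub]
        ring
      simp only [e]
      rw [integral_div, integral_add (hint _ (by fun_prop)) (hint _ (by fun_prop)), ih, ih]
      simp

/-- Completeness of the sines in `L²(0, π)`: by Weierstrass' theorem the polynomials in `cos x`
are dense in `C[0, π]`. -/
theorem eq_zero_of_inner_sineL {u : L2} (h : ∀ n, inner ℝ u (sineL n) = 0) : u = 0 := by
  have hc : √(2 / Real.pi) ≠ 0 := by positivity
  have h0 : ∀ n : ℕ, ∫ x, u x * Real.sin ((n + 1 : ℕ) * x) ∂μI = 0 := by
    intro n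
    have := h n
    rw [sineL, inner_ofCont] at this
    simp only [mul_left_comm _ √(2 / Real.pi)] at this
    rw [integral_const_mul] at this
    push_cast
    exact (mul_eq_zero.1 this).resolve_left hc
  have hint : ∀ g : ℝ → ℝ, Continuous g → Integrable (fun x => u x * g x) μI := fun g hg =>
    MemLp.integrable_mul (p := 2) (q := 2) (Lp.memLp u) (memLp_of_continuous hg)
  have hpoly : ∀ p : Polynomial ℝ,
      ∫ x, u x * (Real.sin x * p.eval (Real.cos x)) ∂μI = 0 := by
    intro p
    induction p using Polynomial.induction_on' with
    | add p q hp hq =>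
      simp only [Polynomial.eval_add, mul_add]
      rw [integral_add (hint _ (by fun_prop)) (hint _ (by fun_prop)), hp, hq, add_zero]
    | monomial j a =>
      have := integral_sin_mul_cos_pow h0 j 1
      simp only [Polynomial.eval_monomial, Nat.cast_one, one_mul] at this ⊢
      simp only [mul_left_comm _ a]
      rw [integral_const_mul, this, mul_zero]
  have hcont : ∀ φ : ℝ → ℝ, Continuous φ → ∫ x, u x * (Real.sin x * φ x) ∂μI = 0 := by
    intro φ hφ
    have hu : Integrable (fun x => u x) μI := (Lp.memLp u).integrable (by norm_num)
    set I := ∫ x, |u x| ∂μI with hI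
    have hI0 : 0 ≤ I := integral_nonneg fun x => abs_nonneg _
    refine abs_eq_zero.1 (le_antisymm (le_of_forall_pos_le_add fun ε hε => ?_) (abs_nonneg _))
    obtain ⟨p, hp⟩ := exists_polynomial_near_of_continuousOn (-1) 1 (fun s => φ (Real.arccos s))
      (by fun_prop) (ε / (I + 1)) (by positivity)
    have e1 : ∫ x, u x * (Real.sin x * φ x) ∂μI
        = ∫ x, u x * (Real.sin x * (φ x - p.eval (Real.cos x))) ∂μI := by
      simp only [mul_sub]
      rw [integral_sub (hint _ (by fun_prop)) (hint _ (by fun_prop)), hpoly, sub_zero]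
    rw [e1, zero_add]
    calc |∫ x, u x * (Real.sin x * (φ x - p.eval (Real.cos x))) ∂μI|
        ≤ ∫ x, |u x| * (ε / (I + 1)) ∂μI := by
          rw [← Real.norm_eq_abs]
          refine norm_integral_le_of_norm_le (hu.abs.mul_const _) ?_
          filter_upwards [ae_restrict_mem measurableSet_Ioo] with x hx
          rw [Real.norm_eq_abs, abs_mul, abs_mul]
          refine mul_le_mul_of_nonneg_left ?_ (abs_nonneg _)
          have hpx := hp (Real.cos x) ⟨Real.neg_one_le_cos x, Real.cos_le_one x⟩
          rw [Real.arccos_cos hx.1.le hx.2.le, abs_sub_comm] at hpx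
          exact (mul_le_of_le_one_left (abs_nonneg _) (Real.abs_sin_le_one x)).trans hpx.le
      _ = I * (ε / (I + 1)) := integral_mul_const _ _
      _ ≤ ε := by
          rw [mul_div_assoc', div_le_iff₀ (by positivity)]
          nlinarith
  have hus : MemLp (fun x => u x * Real.sin x) 2 μI := by
    refine MemLp.mono (Lp.memLp u)
      ((Lp.aestronglyMeasurable u).mul Real.continuous_sin.aestronglyMeasurable)
      (Filter.Eventually.of_forall fun x => ?_)
    rw [norm_mul]
    exact mul_le_of_le_one_right (norm_nonneg _) (Real.abs_sin_le_one x)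
  have hz : hus.toLp _ = (0 : L2) := by
    refine eq_zero_of_integral_test fun φ hφ => ?_
    rw [← hcont φ hφ.smooth.continuous]
    refine integral_congr_ae ?_
    filter_upwards [hus.coeFn_toLp] with x hx
    rw [hx]
    ring
  rw [Lp.eq_zero_iff_ae_eq_zero] at hz ⊢
  filter_upwards [hz, hus.coeFn_toLp, ae_restrict_mem measurableSet_Ioo] with x h1 h2 h3
  rw [h1] at h2
  exact (mul_eq_zero.1 h2.symm).resolve_right (Real.sin_pos_of_mem_Ioo h3).ne'

/-- The Hilbert basis of `L²(0, π)` made of the normalized sines. -/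
def sineBasis : HilbertBasis ℕ ℝ L2 :=
  HilbertBasis.mkOfOrthogonalEqBot orthonormal_sineL (by
    rw [Submodule.eq_bot_iff]
    intro u hu
    refine eq_zero_of_inner_sineL fun n => ?_
    exact (Submodule.mem_orthogonal' _ u).1 hu _ (Submodule.subset_span ⟨n, rfl⟩))

@[simp]
theorem coe_sineBasis : ⇑sineBasis = sineL := HilbertBasis.coe_mkOfOrthogonalEqBot _ _

end Basis

/-! ### Weak derivatives -/

section WeakDerivative

theorem integral_mul_deriv_eq_neg {u v : ℝ → ℝ} (hu : ContDiff ℝ 1 u) (hv : ContDiff ℝ 1 v)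
    (h0 : v 0 = 0) (hπ : v Real.pi = 0) :
    ∫ x, u x * deriv v x ∂μI = - ∫ x, deriv u x * v x ∂μI := by
  have hu' := hu.continuous_deriv le_rfl
  have hv' := hv.continuous_deriv le_rfl
  rw [integral_μI, integral_μI, intervalIntegral.integral_mul_deriv_eq_deriv_mul
    (fun x _ => (hu.differentiable one_ne_zero x).hasDerivAt)
    (fun x _ => (hv.differentiable one_ne_zero x).hasDerivAt)
    (hu'.intervalIntegrable _ _) (hv'.intervalIntegrable _ _), h0, hπ]
  simp

theorem IsTest.contDiff_one {φ : ℝ → ℝ} (h : IsTest φ) : ContDiff ℝ 1 φ :=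
  h.smooth.of_le (by exact_mod_cast le_top)

theorem IsTest.continuous_deriv {φ : ℝ → ℝ} (h : IsTest φ) : Continuous (deriv φ) :=
  h.contDiff_one.continuous_deriv le_rfl

theorem IsTest.apply_zero {φ : ℝ → ℝ} (h : IsTest φ) : φ 0 = 0 :=
  image_eq_zero_of_notMem_tsupport fun h' => lt_irrefl _ (h.supp h').1

theorem IsTest.apply_pi {φ : ℝ → ℝ} (h : IsTest φ) : φ Real.pi = 0 :=
  image_eq_zero_of_notMem_tsupport fun h' => lt_irrefl _ (h.supp h').2

theorem isWeakDeriv_iff {u v : L2} : IsWeakDeriv u v ↔ ∀ (φ : ℝ → ℝ) (h : IsTest φ),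
    inner ℝ u (ofCont (deriv φ) h.continuous_deriv)
      = - inner ℝ v (ofCont φ h.smooth.continuous) := by
  simp only [inner_ofCont]
  rfl

theorem isWeakDeriv_ofCont {g : ℝ → ℝ} (hg : ContDiff ℝ 1 g) :
    IsWeakDeriv (ofCont g hg.continuous) (ofCont (deriv g) (hg.continuous_deriv le_rfl)) := by
  intro φ hφ
  have h := integral_mul_deriv_eq_neg hg hφ.contDiff_one hφ.apply_zero hφ.apply_pi
  have h1 : ∫ x, ofCont g hg.continuous x * deriv φ x ∂μI = ∫ x, g x * deriv φ x ∂μI := by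
    refine integral_congr_ae ?_
    filter_upwards [coeFn_ofCont g hg.continuous] with x hx
    rw [hx]
  have h2 : ∫ x, ofCont (deriv g) (hg.continuous_deriv le_rfl) x * φ x ∂μI
      = ∫ x, deriv g x * φ x ∂μI := by
    refine integral_congr_ae ?_
    filter_upwards [coeFn_ofCont (deriv g) (hg.continuous_deriv le_rfl)] with x hx
    rw [hx]
  rw [h1, h2, h]

theorem IsWeakDeriv.unique {u v v' : L2} (h : IsWeakDeriv u v) (h' : IsWeakDeriv u v') :
    v = v' := by
  rw [isWeakDeriv_iff] at h h'
  rw [← sub_eq_zero]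
  refine eq_zero_of_integral_test fun φ hφ => ?_
  rw [← inner_ofCont _ φ hφ.smooth.continuous, inner_sub_left, ← neg_inj, neg_sub, neg_zero]
  linarith [h φ hφ, h' φ hφ]

end WeakDerivative

/-! ### The space `H¹₀(0, π)` -/

section H10

theorem isClosed_H1 : IsClosed (H1 : Set (WithLp 2 (L2 × L2))) := by
  have : (H1 : Set (WithLp 2 (L2 × L2))) = ⋂ (φ : ℝ → ℝ) (h : IsTest φ),
      {w | inner ℝ w.fst (ofCont (deriv φ) h.continuous_deriv)
        = - inner ℝ w.snd (ofCont φ h.smooth.continuous)} := by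
    ext w
    simp only [mem_iInter, mem_ofPred_eq, ← isWeakDeriv_iff]
    rfl
  rw [this]
  have h1 : Continuous fun w : WithLp 2 (L2 × L2) => w.fst := (WithLp.fstL 2 ℝ L2 L2).continuous
  have h2 : Continuous fun w : WithLp 2 (L2 × L2) => w.snd := (WithLp.sndL 2 ℝ L2 L2).continuous
  exact isClosed_iInter fun φ => isClosed_iInter fun h => isClosed_eq (by fun_prop) (by fun_prop)

/-- The pairs `(φ, φ')` with `φ` a test function. -/
def testSpace : Submodule ℝ (WithLp 2 (L2 × L2)) where
  carrier := {w | ∃ φ : ℝ → ℝ, IsTest φ ∧ w.fst =ᵐ[μI] φ ∧ w.snd =ᵐ[μI] deriv φ}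
  zero_mem' := ⟨0, ⟨contDiff_const, HasCompactSupport.zero, by simp [tsupport]⟩,
    Lp.coeFn_zero _ _ _, by
      have : deriv (0 : ℝ → ℝ) = 0 := by ext; simp
      rw [this]
      exact Lp.coeFn_zero _ _ _⟩
  add_mem' := by
    rintro w w' ⟨φ, hφ, h1, h2⟩ ⟨φ', hφ', h1', h2'⟩
    refine ⟨φ + φ', ⟨hφ.smooth.add hφ'.smooth, hφ.compact.add hφ'.compact,
      (tsupport_add φ φ').trans (union_subset hφ.supp hφ'.supp)⟩,
      (Lp.coeFn_add _ _).trans (h1.add h1'), ?_⟩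
    have : deriv (φ + φ') = deriv φ + deriv φ' := by
      ext x
      exact deriv_add (hφ.contDiff_one.differentiable one_ne_zero x)
        (hφ'.contDiff_one.differentiable one_ne_zero x)
    rw [this]
    exact (Lp.coeFn_add _ _).trans (h2.add h2')
  smul_mem' := by
    rintro c w ⟨φ, hφ, h1, h2⟩
    refine ⟨c • φ, ⟨hφ.smooth.const_smul c, hφ.compact.smul_left,
      (closure_mono (Function.support_const_smul_subset c φ)).trans hφ.supp⟩,
      (Lp.coeFn_smul _ _).trans (h1.const_smul c), ?_⟩
    have : deriv (c • φ) = c • deriv φ := by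
      ext x
      exact deriv_const_smul c (hφ.contDiff_one.differentiable one_ne_zero x)
    rw [this]
    exact (Lp.coeFn_smul _ _).trans (h2.const_smul c)

theorem testSpace_le_H1 : testSpace ≤ H1 := by
  rintro w ⟨φ, hφ, h1, h2⟩
  have e1 : w.fst = ofCont φ hφ.smooth.continuous :=
    Lp.ext (h1.trans (coeFn_ofCont _ _).symm)
  have e2 : w.snd = ofCont (deriv φ) hφ.continuous_deriv :=
    Lp.ext (h2.trans (coeFn_ofCont _ _).symm)
  change IsWeakDeriv w.fst w.snd
  rw [e1, e2]
  exact isWeakDeriv_ofCont hφ.contDiff_one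

theorem mem_H10_iff {w : WithLp 2 (L2 × L2)} :
    w ∈ H10 ↔ w ∈ testSpace.topologicalClosure := by
  set S : Submodule ℝ H1 := Submodule.span ℝ {w : H1 | ∃ φ : ℝ → ℝ, IsTest φ ∧
    w.1.fst =ᵐ[μI] φ ∧ w.1.snd =ᵐ[μI] deriv φ} with hS
  have himage : ((↑) : H1 → WithLp 2 (L2 × L2)) '' (S : Set H1) = testSpace := by
    ext w
    constructor
    · rintro ⟨v, hv, rfl⟩
      exact (Submodule.span_le (p := testSpace.comap H1.subtype)).2 (fun _ h => h) hv
    · intro hw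
      exact ⟨⟨w, testSpace_le_H1 hw⟩, Submodule.subset_span hw, rfl⟩
  constructor
  · rintro ⟨v, hv, rfl⟩
    have h : (v : WithLp 2 (L2 × L2)) ∈ closure (((↑) : H1 → _) '' (S : Set H1)) :=
      closure_subtype.1 hv
    rw [himage] at h
    exact h
  · intro hw
    have hw1 : w ∈ H1 := closure_minimal testSpace_le_H1 isClosed_H1 hw
    have h : w ∈ closure (((↑) : H1 → _) '' (S : Set H1)) := by
      rw [himage]
      exact hw
    exact ⟨⟨w, hw1⟩, closure_subtype.2 h, rfl⟩

theorem isClosed_H10 : IsClosed (H10 : Set (WithLp 2 (L2 × L2))) := by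
  have : (H10 : Set (WithLp 2 (L2 × L2))) = testSpace.topologicalClosure := by
    ext w
    exact mem_H10_iff
  rw [this]
  exact testSpace.isClosed_topologicalClosure

/-- A closed property that holds for test functions holds on `H¹₀`. -/
theorem H10_induction {Q : WithLp 2 (L2 × L2) → Prop} (hQ : IsClosed {w | Q w})
    (h : ∀ w ∈ testSpace, Q w) {w : WithLp 2 (L2 × L2)} (hw : w ∈ H10) : Q w :=
  closure_minimal h hQ (mem_H10_iff.1 hw)

theorem H10_le_H1 : H10 ≤ H1 := fun _ hw => H10_induction isClosed_H1 testSpace_le_H1 hw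

/-- Integration by parts: no boundary terms if one of the functions is in `H¹₀`. -/
theorem IsWeakDeriv.inner_snd {u v : L2} (h : IsWeakDeriv u v) {w : WithLp 2 (L2 × L2)}
    (hw : w ∈ H10) : inner ℝ u w.snd = - inner ℝ v w.fst := by
  have h1 : Continuous fun w : WithLp 2 (L2 × L2) => w.fst := (WithLp.fstL 2 ℝ L2 L2).continuous
  have h2 : Continuous fun w : WithLp 2 (L2 × L2) => w.snd := (WithLp.sndL 2 ℝ L2 L2).continuous
  refine H10_induction (Q := fun w => inner ℝ u w.snd = - inner ℝ v w.fst)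
    (isClosed_eq (by fun_prop) (by fun_prop)) ?_ hw
  rintro w ⟨φ, hφ, e1, e2⟩
  rw [inner_eq_integral_of_ae u w.snd e2, inner_eq_integral_of_ae v w.fst e1]
  exact h φ hφ

theorem IsTest.abs_le {φ : ℝ → ℝ} (h : IsTest φ) {x : ℝ} (hx : x ∈ Ioo 0 Real.pi) :
    |φ x| ≤ √Real.pi * ‖ofCont (deriv φ) h.continuous_deriv‖ := by
  have hI : ∀ g : ℝ → ℝ, Continuous g → IntervalIntegrable g volume 0 Real.pi := fun g hg =>
    hg.intervalIntegrable _ _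
  have h1 : φ x = ∫ s in (0 : ℝ)..x, deriv φ s := by
    rw [intervalIntegral.integral_deriv_eq_sub
      (fun s _ => h.contDiff_one.differentiable one_ne_zero s)
      (h.continuous_deriv.intervalIntegrable _ _), h.apply_zero, sub_zero]
  have hc : Continuous fun s => |deriv φ s| := h.continuous_deriv.abs
  have h2 : |φ x| ≤ ∫ s in (0 : ℝ)..Real.pi, |deriv φ s| := by
    rw [h1]
    refine (intervalIntegral.abs_integral_le_integral_abs hx.1.le).trans ?_
    exact intervalIntegral.integral_mono_interval le_rfl hx.1.le hx.2.le
      (Filter.Eventually.of_forall fun s => abs_nonneg _) (hc.intervalIntegrable _ _)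
  have h3 : ∫ s in (0 : ℝ)..Real.pi, |deriv φ s|
      = inner ℝ (ofCont (fun _ => 1) continuous_const) (ofCont (fun s => |deriv φ s|) hc) := by
    rw [inner_ofCont_ofCont]
    simp
  have h4 : ‖ofCont (fun s => |deriv φ s|) hc‖ = ‖ofCont (deriv φ) h.continuous_deriv‖ := by
    rw [← sq_eq_sq₀ (norm_nonneg _) (norm_nonneg _), ← real_inner_self_eq_norm_sq,
      ← real_inner_self_eq_norm_sq, inner_ofCont_ofCont, inner_ofCont_ofCont]
    simp
  have h5 : ‖ofCont (fun _ => 1) continuous_const‖ = √Real.pi := by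
    rw [← Real.sqrt_sq (norm_nonneg (ofCont (fun _ => 1) continuous_const)),
      ← real_inner_self_eq_norm_sq, inner_ofCont_ofCont]
    simp
  rw [h3] at h2
  refine h2.trans ((real_inner_le_norm _ _).trans ?_)
  rw [h4, h5]

/-- The Sobolev inequality `‖u‖_∞ ≤ √π ‖u'‖₂` on `H¹₀(0, π)`. -/
theorem ae_abs_le_of_mem_H10 {w : WithLp 2 (L2 × L2)} (hw : w ∈ H10) :
    ∀ᵐ x ∂μI, |w.fst x| ≤ √Real.pi * ‖w.snd‖ := by
  set o : L2 := ofCont (fun _ => 1) continuous_const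
  have key : |w.fst| ≤ (√Real.pi * ‖w.snd‖) • o := by
    have h1 : Continuous fun w : WithLp 2 (L2 × L2) => w.fst :=
      (WithLp.fstL 2 ℝ L2 L2).continuous
    have h2 : Continuous fun w : WithLp 2 (L2 × L2) => w.snd :=
      (WithLp.sndL 2 ℝ L2 L2).continuous
    refine H10_induction (Q := fun w => |w.fst| ≤ (√Real.pi * ‖w.snd‖) • o)
      (isClosed_le (h1.sup h1.neg) (by fun_prop)) ?_ hw
    rintro w ⟨φ, hφ, e1, e2⟩
    have e3 : w.snd = ofCont (deriv φ) hφ.continuous_deriv :=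
      Lp.ext (e2.trans (coeFn_ofCont _ _).symm)
    rw [← Lp.coeFn_le]
    filter_upwards [Lp.coeFn_abs w.fst, Lp.coeFn_smul (√Real.pi * ‖w.snd‖) o,
      coeFn_ofCont (fun _ => 1) continuous_const, e1, ae_restrict_mem measurableSet_Ioo]
      with x a1 a2 a3 a4 a5
    rw [a1, a2, Pi.smul_apply, a3, a4, smul_eq_mul, mul_one, e3]
    exact hφ.abs_le a5
  rw [← Lp.coeFn_le] at key
  filter_upwards [key, Lp.coeFn_abs w.fst, Lp.coeFn_smul (√Real.pi * ‖w.snd‖) o,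
      coeFn_ofCont (fun _ => 1) continuous_const] with x a0 a1 a2 a3
  rwa [a1, a2, Pi.smul_apply, a3, smul_eq_mul, mul_one] at a0

end H10

/-! ### Smooth functions vanishing at the ends -/

section Cutoff

theorem exists_bound_deriv_smoothTransition : ∃ B : ℝ, 0 ≤ B ∧
    (∀ x, |deriv Real.smoothTransition x| ≤ B) ∧
    ∀ x, 1 < x → deriv Real.smoothTransition x = 0 := by
  have hcd : ContDiff ℝ 1 Real.smoothTransition := Real.smoothTransition.contDiff (n := 1)
  have h1 : ∀ x, 1 < x → deriv Real.smoothTransition x = 0 := by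
    intro x hx
    have : Real.smoothTransition =ᶠ[nhds x] fun _ => 1 := by
      filter_upwards [lt_mem_nhds hx] with y hy
      exact Real.smoothTransition.one_of_one_le hy.le
    rw [this.deriv_eq, deriv_const]
  have h0 : ∀ x, x < 0 → deriv Real.smoothTransition x = 0 := by
    intro x hx
    have : Real.smoothTransition =ᶠ[nhds x] fun _ => 0 := by
      filter_upwards [gt_mem_nhds hx] with y hy
      exact Real.smoothTransition.zero_of_nonpos hy.le
    rw [this.deriv_eq, deriv_const]
  obtain ⟨B, hB⟩ := (isCompact_Icc (a := (0 : ℝ)) (b := 1)).exists_bound_of_continuousOn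
    (hcd.continuous_deriv le_rfl).continuousOn
  refine ⟨|B|, abs_nonneg _, fun x => ?_, h1⟩
  rcases lt_or_ge x 0 with hx | hx
  · rw [h0 x hx, abs_zero]; exact abs_nonneg _
  rcases lt_or_ge 1 x with hx' | hx'
  · rw [h1 x hx', abs_zero]; exact abs_nonneg _
  · exact (hB x ⟨hx, hx'⟩).trans (le_abs_self B)

/-- A smooth function that vanishes at `0` and at `π` belongs to `H¹₀(0, π)`. With the cutoffs
`χ_k`, equal to `1` at distance more than `2/k` of the ends, the derivatives of `χ_k S` stay
bounded, since `|S|` is at most `N` times the distance to the ends where `χ_k'` is of order `k`. -/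
theorem toLp_mem_H10 {S : ℝ → ℝ} (hS : ContDiff ℝ ∞ S) (hS' : Continuous (deriv S)) (N : ℝ)
    (hS0 : ∀ x ∈ Ioo 0 Real.pi, |S x| ≤ N * x)
    (hSπ : ∀ x ∈ Ioo 0 Real.pi, |S x| ≤ N * (Real.pi - x))
    (hSN : ∀ x ∈ Ioo 0 Real.pi, |deriv S x| ≤ N) :
    WithLp.toLp 2 (ofCont S hS.continuous, ofCont (deriv S) hS') ∈ H10 := by
  obtain ⟨B, hB0, hB, hB1⟩ := exists_bound_deriv_smoothTransition
  have hN : 0 ≤ N := by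
    have hm : Real.pi / 2 ∈ Ioo 0 Real.pi := ⟨by positivity, by linarith [Real.pi_pos]⟩
    exact (abs_nonneg _).trans (hSN _ hm)
  set h := Real.smoothTransition with hh
  have hcd : ContDiff ℝ ∞ h := Real.smoothTransition.contDiff (n := ⊤)
  have hcd1 : ContDiff ℝ 1 h := hcd.of_le (by exact_mod_cast le_top)
  have hd : ∀ x, HasDerivAt h (deriv h x) x := fun x =>
    (hcd1.differentiable one_ne_zero x).hasDerivAt
  have hdS : ∀ x, HasDerivAt S (deriv S x) x := fun x =>
    ((hS.of_le (by exact_mod_cast le_top : (1 : WithTop ℕ∞) ≤ ∞)).differentiable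
      one_ne_zero x).hasDerivAt
  set φ : ℕ → ℝ → ℝ := fun k x =>
    S x * (h ((k + 1) * x - 1) * h ((k + 1) * (Real.pi - x) - 1)) with hφ
  set ψ : ℕ → ℝ → ℝ := fun k x =>
    deriv S x * (h ((k + 1) * x - 1) * h ((k + 1) * (Real.pi - x) - 1))
      + S x * ((k + 1) * deriv h ((k + 1) * x - 1) * h ((k + 1) * (Real.pi - x) - 1)
        - h ((k + 1) * x - 1) * ((k + 1) * deriv h ((k + 1) * (Real.pi - x) - 1))) with hψ
  have hderiv : ∀ k, deriv (φ k) = ψ k := by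
    intro k
    ext x
    have a1 : HasDerivAt (fun x : ℝ => (k + 1 : ℝ) * x - 1) (k + 1) x := by
      simpa using ((hasDerivAt_id x).const_mul (k + 1 : ℝ)).sub_const 1
    have a2 : HasDerivAt (fun x : ℝ => (k + 1 : ℝ) * (Real.pi - x) - 1) (-(k + 1)) x := by
      simpa using (((hasDerivAt_id x).const_sub Real.pi).const_mul (k + 1 : ℝ)).sub_const 1
    have := ((hdS x).mul (((hd _).comp x a1).mul ((hd _).comp x a2))).deriv
    refine Eq.trans this ?_
    simp only [hψ, Pi.mul_apply, Function.comp_apply]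
    ring
  have htest : ∀ k, IsTest (φ k) := by
    intro k
    have hk : (0 : ℝ) < k + 1 := by positivity
    have hsupp : Function.support (φ k) ⊆ Icc (1 / (k + 1 : ℝ)) (Real.pi - 1 / (k + 1 : ℝ)) := by
      intro x hx
      have h1 : h ((k + 1) * x - 1) ≠ 0 := fun h0 => hx (by simp [hφ, h0])
      have h2 : h ((k + 1) * (Real.pi - x) - 1) ≠ 0 := fun h0 => hx (by simp [hφ, h0])
      rw [hh, Ne, Real.smoothTransition.zero_iff_nonpos, not_le] at h1 h2
      constructor
      · rw [div_le_iff₀ hk]; linarith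
      · rw [le_sub_comm, div_le_iff₀ hk]; linarith
    refine ⟨?_, HasCompactSupport.of_support_subset_isCompact isCompact_Icc hsupp, ?_⟩
    · exact hS.mul ((hcd.comp (by fun_prop)).mul (hcd.comp (by fun_prop)))
    · refine (closure_minimal hsupp isClosed_Icc).trans fun x hx => ?_
      have : 0 < 1 / (k + 1 : ℝ) := by positivity
      exact ⟨this.trans_le hx.1, hx.2.trans_lt (by linarith)⟩
  have hψc : ∀ k, Continuous (ψ k) := fun k => hderiv k ▸ (htest k).continuous_deriv
  -- eventually `χ_k = 1` and `χ_k' = 0` at a given point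
  have hev : ∀ x ∈ Ioo 0 Real.pi, ∀ᶠ k : ℕ in Filter.atTop,
      1 < (k + 1 : ℝ) * x - 1 ∧ 1 < (k + 1 : ℝ) * (Real.pi - x) - 1 := by
    intro x hx
    have key : ∀ y : ℝ, 0 < y → ∀ᶠ k : ℕ in Filter.atTop, 1 < (k + 1 : ℝ) * y - 1 := by
      intro y hy
      filter_upwards [(tendsto_natCast_atTop_atTop (R := ℝ)).eventually_gt_atTop (2 / y)]
        with k hk
      rw [div_lt_iff₀ hy] at hk
      linarith
    exact (key x hx.1).and (key _ (sub_pos.2 hx.2))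
  have hχ : ∀ y z : ℝ, |h y * h z| ≤ 1 := by
    intro y z
    rw [abs_mul, abs_of_nonneg (Real.smoothTransition.nonneg y),
      abs_of_nonneg (Real.smoothTransition.nonneg z)]
    exact mul_le_one₀ (Real.smoothTransition.le_one y) (Real.smoothTransition.nonneg z)
      (Real.smoothTransition.le_one z)
  -- the product of `|S| ≤ N d` and of the derivative of the cutoff in the distance `d`
  have hcut : ∀ (k : ℕ) (s d : ℝ), 0 < d → |s| ≤ N * d →
      |s| * ((k + 1) * |deriv h ((k + 1) * d - 1)|) ≤ 2 * N * B := by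
    intro k s d hd0 hs
    rcases lt_or_ge 1 ((k + 1) * d - 1) with h1 | h1
    · rw [hB1 _ h1]; simp; positivity
    · calc |s| * ((k + 1) * |deriv h ((k + 1) * d - 1)|) ≤ N * d * ((k + 1) * B) := by
            gcongr
            exact hB _
        _ = N * B * ((k + 1) * d) := by ring
        _ ≤ N * B * 2 := by
            gcongr
            linarith
        _ = 2 * N * B := by ring
  rw [mem_H10_iff, ← Submodule.orthogonal_orthogonal_eq_closure, Submodule.mem_orthogonal]
  intro b hb
  rw [WithLp.prod_inner_apply]
  have horth : ∀ k, inner ℝ b.fst (ofCont (φ k) (htest k).smooth.continuous)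
      + inner ℝ b.snd (ofCont (ψ k) (hψc k)) = 0 := by
    intro k
    have hae : ofCont (ψ k) (hψc k) =ᵐ[μI] deriv (φ k) := by
      rw [hderiv k]
      exact coeFn_ofCont (ψ k) (hψc k)
    have := (Submodule.mem_orthogonal' _ b).1 hb
      (WithLp.toLp 2 (ofCont (φ k) (htest k).smooth.continuous, ofCont (ψ k) (hψc k)))
      ⟨φ k, htest k, coeFn_ofCont _ (htest k).smooth.continuous, hae⟩
    rwa [WithLp.prod_inner_apply] at this
  have l1 := tendsto_inner_ofCont b.fst (fun k => (htest k).smooth.continuous) hS.continuous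
    (N * Real.pi) (fun k x hx => by
      rw [hφ, abs_mul]
      calc |S x| * |h ((k + 1) * x - 1) * h ((k + 1) * (Real.pi - x) - 1)| ≤ |S x| * 1 := by
            gcongr
            exact hχ _ _
        _ ≤ N * Real.pi := by
            rw [mul_one]
            refine (hS0 x hx).trans ?_
            gcongr
            exact hx.2.le)
    (fun x hx => by
      filter_upwards [hev x hx] with k hk
      simp only [hφ, hh, Real.smoothTransition.one_of_one_le hk.1.le,
        Real.smoothTransition.one_of_one_le hk.2.le, mul_one])
  have l2 := tendsto_inner_ofCont b.snd hψc hS' (N + (2 * N * B + 2 * N * B)) (fun k x hx => by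
      have t1 : |deriv S x * (h ((k + 1) * x - 1) * h ((k + 1) * (Real.pi - x) - 1))| ≤ N := by
        rw [abs_mul]
        exact (mul_le_of_le_one_right (abs_nonneg _) (hχ _ _)).trans (hSN x hx)
      have hle : ∀ y, |h y| ≤ 1 := fun y => by
        rw [abs_of_nonneg (Real.smoothTransition.nonneg y)]
        exact Real.smoothTransition.le_one y
      have hk : |(k + 1 : ℝ)| = k + 1 := abs_of_nonneg (by positivity)
      have t2 : |S x * ((k + 1) * deriv h ((k + 1) * x - 1) * h ((k + 1) * (Real.pi - x) - 1))|
          ≤ 2 * N * B := by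
        refine le_trans ?_ (hcut k (S x) x hx.1 (hS0 x hx))
        rw [abs_mul, abs_mul, abs_mul, hk]
        exact mul_le_mul_of_nonneg_left (mul_le_of_le_one_right (by positivity) (hle _))
          (abs_nonneg _)
      have t3 : |S x * (h ((k + 1) * x - 1) * ((k + 1) * deriv h ((k + 1) * (Real.pi - x) - 1)))|
          ≤ 2 * N * B := by
        refine le_trans ?_ (hcut k (S x) _ (sub_pos.2 hx.2) (hSπ x hx))
        rw [abs_mul, abs_mul, abs_mul (k + 1 : ℝ), hk]
        exact mul_le_mul_of_nonneg_left (mul_le_of_le_one_left (by positivity) (hle _))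
          (abs_nonneg _)
      simp only [hψ]
      rw [mul_sub (S x)]
      exact (abs_add_le _ _).trans (add_le_add t1 ((abs_sub _ _).trans (add_le_add t2 t3))))
    (fun x hx => by
      filter_upwards [hev x hx] with k hk
      simp only [hψ, hB1 _ hk.1, hB1 _ hk.2]
      simp only [hh, Real.smoothTransition.one_of_one_le hk.1.le,
        Real.smoothTransition.one_of_one_le hk.2.le]
      ring)
  exact tendsto_nhds_unique (l1.add l2) (by simp only [horth]; exact tendsto_const_nhds)

end Cutoff

/-! ### The inverse square root of the Dirichlet Laplacian -/

section SineOperators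

theorem sine_cosine_mem_H10 (n : ℕ) :
    (WithLp.toLp 2 (sineL n, (n + 1 : ℝ) • cosineL n) : WithLp 2 (L2 × L2)) ∈ H10 := by
  set c := √(2 / Real.pi) with hc
  have hc0 : 0 ≤ c := Real.sqrt_nonneg _
  have hn : |(n + 1 : ℝ)| = n + 1 := abs_of_nonneg (by positivity)
  have hder : deriv (fun x : ℝ => c * Real.sin ((n + 1) * x))
      = fun x => (n + 1 : ℝ) * (c * Real.cos ((n + 1) * x)) := by
    ext x
    have a1 : HasDerivAt (fun x : ℝ => (n + 1 : ℝ) * x) (n + 1) x := by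
      simpa using (hasDerivAt_id x).const_mul (n + 1 : ℝ)
    have := (((Real.hasDerivAt_sin _).comp x a1).const_mul c).deriv
    refine Eq.trans this ?_
    ring
  have hcont : Continuous (deriv fun x : ℝ => c * Real.sin ((n + 1) * x)) := by
    rw [hder]; fun_prop
  have h := toLp_mem_H10 (S := fun x : ℝ => c * Real.sin ((n + 1) * x)) (by fun_prop) hcont
    (c * (n + 1)) (fun x hx => by
      rw [abs_mul, abs_of_nonneg hc0, mul_assoc]
      refine mul_le_mul_of_nonneg_left ((Real.abs_sin_le_abs).trans ?_) hc0
      rw [abs_mul, hn, abs_of_pos hx.1])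
    (fun x hx => by
      have e : |Real.sin ((n + 1) * x)| = |Real.sin ((n + 1) * (Real.pi - x))| := by
        have : ((n : ℝ) + 1) * (Real.pi - x) = (n + 1 : ℕ) * Real.pi - (n + 1) * x := by
          push_cast; ring
        rw [this, Real.sin_nat_mul_pi_sub, abs_neg, abs_mul, abs_pow]
        simp
      rw [abs_mul, abs_of_nonneg hc0, mul_assoc, e]
      refine mul_le_mul_of_nonneg_left ((Real.abs_sin_le_abs).trans ?_) hc0
      rw [abs_mul, hn, abs_of_pos (sub_pos.2 hx.2)])
    (fun x _ => by
      rw [hder, abs_mul, abs_mul, hn, abs_of_nonneg hc0]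
      have := mul_le_mul_of_nonneg_left (Real.abs_cos_le_one ((n + 1) * x)) hc0
      nlinarith [n.cast_nonneg (α := ℝ)])
  have e : (n + 1 : ℝ) • cosineL n = ofCont _ hcont := by
    refine Lp.ext ?_
    filter_upwards [Lp.coeFn_smul (n + 1 : ℝ) (cosineL n), coeFn_ofCont _ hcont,
      coeFn_ofCont (fun x => c * Real.cos ((n + 1) * x)) (by fun_prop)] with x h1 h2 h3
    rw [h1, h2, hder, Pi.smul_apply, cosineL, h3, smul_eq_mul]
  rw [e]
  exact h

theorem isWeakDeriv_cosineL (n : ℕ) : IsWeakDeriv (cosineL n) (-((n + 1 : ℝ) • sineL n)) := by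
  set c := √(2 / Real.pi) with hc
  have hder : deriv (fun x : ℝ => c * Real.cos ((n + 1) * x))
      = fun x => -((n + 1 : ℝ) * (c * Real.sin ((n + 1) * x))) := by
    ext x
    have a1 : HasDerivAt (fun x : ℝ => (n + 1 : ℝ) * x) (n + 1) x := by
      simpa using (hasDerivAt_id x).const_mul (n + 1 : ℝ)
    have := (((Real.hasDerivAt_cos _).comp x a1).const_mul c).deriv
    refine Eq.trans this ?_
    ring
  have h := isWeakDeriv_ofCont (g := fun x : ℝ => c * Real.cos ((n + 1) * x)) (by fun_prop)
  have hcont : Continuous (deriv fun x : ℝ => c * Real.cos ((n + 1) * x)) := by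
    rw [hder]; fun_prop
  have e : -((n + 1 : ℝ) • sineL n) = ofCont _ hcont := by
    refine Lp.ext ?_
    filter_upwards [Lp.coeFn_neg ((n + 1 : ℝ) • sineL n), Lp.coeFn_smul (n + 1 : ℝ) (sineL n),
      coeFn_ofCont _ hcont,
      coeFn_ofCont (fun x => c * Real.sin ((n + 1) * x)) (by fun_prop)] with x h1 h2 h3 h4
    rw [h1, h3, hder, Pi.neg_apply, h2, Pi.smul_apply, sineL, h4, smul_eq_mul]
  rw [e]
  exact h

theorem inner_cosineL_snd {w : WithLp 2 (L2 × L2)} (hw : w ∈ H10) (n : ℕ) :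
    inner ℝ (cosineL n) w.snd = (n + 1) * inner ℝ (sineL n) w.fst := by
  rw [(isWeakDeriv_cosineL n).inner_snd hw, inner_neg_left, neg_neg, real_inner_smul_left]

/-- The isometry of `L²(0, π)` that maps the normalized sines to the normalized cosines. -/
def sineToCosine : L2 →ₗᵢ[ℝ] L2 :=
  orthonormal_cosineL.orthogonalFamily.linearIsometry.comp
    sineBasis.repr.toLinearIsometry

theorem sineToCosine_sineL (n : ℕ) : sineToCosine (sineL n) = cosineL n := by
  have h : sineBasis.repr (sineL n) = lp.single 2 n (1 : ℝ) := by
    rw [← coe_sineBasis, sineBasis.repr_self]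
  change orthonormal_cosineL.orthogonalFamily.linearIsometry (sineBasis.repr (sineL n)) = _
  rw [h, OrthogonalFamily.linearIsometry_apply_single]
  simp

theorem inner_sineL_adjoint (n : ℕ) (x : L2) :
    inner ℝ (sineL n) (sineToCosine.toContinuousLinearMap.adjoint x)
      = inner ℝ (cosineL n) x := by
  rw [ContinuousLinearMap.adjoint_inner_right]
  exact congrArg (fun y => inner ℝ y x) (sineToCosine_sineL n)

theorem abs_inv_le_one {a : ℝ} (ha : 1 ≤ a) : |a⁻¹| ≤ 1 := by
  rw [abs_of_nonneg (by positivity)]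
  exact inv_le_one_of_one_le₀ ha

theorem one_le_cast_add_one (n : ℕ) : (1 : ℝ) ≤ n + 1 := by
  linarith [n.cast_nonneg (α := ℝ)]

/-- The inverse square root of the Dirichlet Laplacian on `(0, π)`. -/
def invSqrtLaplacian : L2 →L[ℝ] L2 :=
  diag sineBasis (fun n => (n + 1 : ℝ)⁻¹) fun n => abs_inv_le_one (one_le_cast_add_one n)

theorem inner_sineL_invSqrtLaplacian (n : ℕ) (x : L2) :
    inner ℝ (sineL n) (invSqrtLaplacian x) = (n + 1 : ℝ)⁻¹ * inner ℝ (sineL n) x := by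
  rw [← coe_sineBasis, invSqrtLaplacian, inner_diag]

/-- `∑ aₙ sin((n+1)x) ↦ (∑ aₙ sin((n+1)x)/(n+1), ∑ aₙ cos((n+1)x))`. -/
def liftH10Pair : L2 →L[ℝ] WithLp 2 (L2 × L2) :=
  ((WithLp.prodContinuousLinearEquiv 2 ℝ L2 L2).symm : L2 × L2 →L[ℝ] WithLp 2 (L2 × L2)).comp
    (invSqrtLaplacian.prod sineToCosine.toContinuousLinearMap)

theorem liftH10Pair_apply (a : L2) :
    liftH10Pair a = WithLp.toLp 2 (invSqrtLaplacian a, sineToCosine a) := rfl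

theorem liftH10Pair_mem (a : L2) : liftH10Pair a ∈ H10 := by
  have hle : (Submodule.span ℝ (Set.range sineBasis)).topologicalClosure
      ≤ H10.comap (liftH10Pair : L2 →ₗ[ℝ] WithLp 2 (L2 × L2)) := by
    refine Submodule.topologicalClosure_minimal _ (Submodule.span_le.2 ?_)
      (isClosed_H10.preimage liftH10Pair.continuous)
    rintro _ ⟨n, rfl⟩
    have h := H10.smul_mem (n + 1 : ℝ)⁻¹ (sine_cosine_mem_H10 n)
    change liftH10Pair (sineBasis n) ∈ H10
    convert h using 1
    have hn : (n + 1 : ℝ) ≠ 0 := by positivity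
    have h1 : invSqrtLaplacian (sineL n) = (n + 1 : ℝ)⁻¹ • sineL n := by
      refine ext_coord sineBasis fun j => ?_
      rw [coe_sineBasis, inner_sineL_invSqrtLaplacian, real_inner_smul_right,
        orthonormal_iff_ite.1 orthonormal_sineL j n]
      split_ifs with hjn
      · rw [hjn]
      · simp
    rw [coe_sineBasis, liftH10Pair_apply, h1, sineToCosine_sineL, ← WithLp.toLp_smul,
      Prod.smul_mk, inv_smul_smul₀ hn]
  rw [sineBasis.dense_span] at hle
  exact hle (Submodule.mem_top (x := a))

end SineOperators

/-! ### The Sobolev spaces as domains of diagonal operators -/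

section Realization

/-- A Hilbert space `V ⊆ L²(0, π)` which is the domain of the positive operator `Λ` with
eigenvalues `lam n` on the normalized sines, and whose bilinear form `(B u, B v)` is the form of
`Λ²`. Here `ι` is the inclusion, `D` is `Λ : V → L²` and `P` is `Λ⁻¹ : L² → V`. -/
structure Realization (V : Type*) [NormedAddCommGroup V] [NormedSpace ℝ V] (lam : ℕ → ℝ)
    (ι B : V →L[ℝ] L2) where
  /-- The operator `Λ`. -/
  D : V →L[ℝ] L2
  /-- The operator `Λ⁻¹`. -/
  P : L2 →L[ℝ] V
  one_le : ∀ n, 1 ≤ lam n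
  inner_D : ∀ n u, inner ℝ (sineL n) (D u) = lam n * inner ℝ (sineL n) (ι u)
  inner_P : ∀ n a, inner ℝ (sineL n) (ι (P a)) = (lam n)⁻¹ * inner ℝ (sineL n) a
  inner_B_P : ∀ a u, inner ℝ (B (P a)) (B u) = inner ℝ a (D u)
  injective : Function.Injective ι

theorem H10.toL2_injective : Function.Injective H10.toL2 := by
  intro u u' h
  have h1 : u.1.fst = u'.1.fst := h
  have h2 : u.1.snd = u'.1.snd := by
    have a : IsWeakDeriv u.1.fst u.1.snd := H10_le_H1 u.2
    have a' : IsWeakDeriv u'.1.fst u'.1.snd := H10_le_H1 u'.2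
    rw [h1] at a
    exact a.unique a'
  exact Subtype.ext (WithLp.ofLp_injective 2 (Prod.ext h1 h2))

/-- `H¹₀(0, π)` is the domain of the square root of the Dirichlet Laplacian. -/
def realizationH10 : Realization H10 (fun n => n + 1) H10.toL2 H10.dx where
  D := sineToCosine.toContinuousLinearMap.adjoint.comp H10.dx
  P := liftH10Pair.codRestrict H10 liftH10Pair_mem
  one_le := one_le_cast_add_one
  inner_D n u := by
    rw [ContinuousLinearMap.comp_apply, inner_sineL_adjoint]
    exact inner_cosineL_snd u.2 n
  inner_P n a := inner_sineL_invSqrtLaplacian n a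
  inner_B_P a u := by
    rw [ContinuousLinearMap.comp_apply, ContinuousLinearMap.adjoint_inner_right]
    rfl
  injective := H10.toL2_injective

theorem isWeakDeriv_sineToCosine (a : L2) :
    IsWeakDeriv (sineToCosine (invSqrtLaplacian a)) (-a) := by
  rw [isWeakDeriv_iff]
  intro φ hφ
  set w : WithLp 2 (L2 × L2) :=
    WithLp.toLp 2 (ofCont φ hφ.smooth.continuous, ofCont (deriv φ) hφ.continuous_deriv) with hw
  have hmem : w ∈ H10 := mem_H10_iff.2 <| testSpace.le_topologicalClosure
    ⟨φ, hφ, coeFn_ofCont _ hφ.smooth.continuous, coeFn_ofCont _ hφ.continuous_deriv⟩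
  have h1 : inner ℝ (sineToCosine (invSqrtLaplacian a)) w.snd
      = inner ℝ (invSqrtLaplacian a) (sineToCosine.toContinuousLinearMap.adjoint w.snd) := by
    rw [ContinuousLinearMap.adjoint_inner_right]
    rfl
  have h2 : invSqrtLaplacian (sineToCosine.toContinuousLinearMap.adjoint w.snd) = w.fst := by
    refine ext_coord sineBasis fun n => ?_
    have hn : (n + 1 : ℝ) ≠ 0 := by positivity
    rw [coe_sineBasis, inner_sineL_invSqrtLaplacian, inner_sineL_adjoint, inner_cosineL_snd hmem,
      inv_mul_cancel_left₀ hn]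
  change inner ℝ (sineToCosine (invSqrtLaplacian a)) w.snd = - inner ℝ (-a) w.fst
  rw [h1, inner_neg_left, neg_neg, ← h2]
  exact inner_diag_left sineBasis _ _ _

theorem H2H10.inner_sineL_dxx (u : H2H10) (n : ℕ) :
    inner ℝ (sineL n) (H2H10.dxx u) = -((n + 1 : ℝ) ^ 2 * inner ℝ (sineL n) (H2H10.toL2 u)) := by
  have h1 := IsWeakDeriv.inner_snd u.2.2 (sine_cosine_mem_H10 n)
  have h2 := inner_cosineL_snd u.2.1 n
  change inner ℝ u.1.fst.snd ((n + 1 : ℝ) • cosineL n) = - inner ℝ u.1.snd (sineL n) at h1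
  rw [real_inner_smul_right, real_inner_comm, h2, real_inner_comm (sineL n) u.1.snd] at h1
  change inner ℝ (sineL n) u.1.snd = -((n + 1 : ℝ) ^ 2 * inner ℝ (sineL n) u.1.fst.fst)
  linarith

/-- `Λ⁻¹` for `Λ` the Dirichlet Laplacian, with values in triples `((u, u'), u'')`. -/
def liftH2Triple : L2 →L[ℝ] WithLp 2 (WithLp 2 (L2 × L2) × L2) :=
  ((WithLp.prodContinuousLinearEquiv 2 ℝ (WithLp 2 (L2 × L2)) L2).symm :
    WithLp 2 (L2 × L2) × L2 →L[ℝ] WithLp 2 (WithLp 2 (L2 × L2) × L2)).comp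
    ((liftH10Pair.comp invSqrtLaplacian).prod (-ContinuousLinearMap.id ℝ L2))

theorem liftH2Triple_mem (a : L2) : liftH2Triple a ∈ H2H10 :=
  ⟨liftH10Pair_mem _, isWeakDeriv_sineToCosine a⟩

/-- `H² ∩ H¹₀(0, π)` is the domain of the Dirichlet Laplacian. -/
def realizationH2H10 : Realization H2H10 (fun n => (n + 1 : ℝ) ^ 2) H2H10.toL2 H2H10.dxx where
  D := -H2H10.dxx
  P := liftH2Triple.codRestrict H2H10 liftH2Triple_mem
  one_le n := one_le_pow₀ (one_le_cast_add_one n)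
  inner_D n u := by
    rw [neg_apply, inner_neg_right, H2H10.inner_sineL_dxx, neg_neg]
  inner_P n a := by
    change inner ℝ (sineL n) (invSqrtLaplacian (invSqrtLaplacian a)) = _
    rw [inner_sineL_invSqrtLaplacian, inner_sineL_invSqrtLaplacian, ← mul_assoc, ← mul_inv, sq]
  inner_B_P a u := by
    rw [neg_apply, inner_neg_right, ← inner_neg_left]
    rfl
  injective := by
    intro u u' h
    have h1 : (⟨u.1.fst, u.2.1⟩ : H10) = ⟨u'.1.fst, u'.2.1⟩ := H10.toL2_injective h
    have h1' : u.1.fst = u'.1.fst := congrArg Subtype.val h1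
    have h2 : u.1.snd = u'.1.snd := by
      have a := u.2.2
      rw [h1'] at a
      exact a.unique u'.2.2
    exact Subtype.ext (WithLp.ofLp_injective 2 (Prod.ext h1' h2))

/-- The Sobolev inequality on `H² ∩ H¹₀(0, π)`. -/
theorem H2H10.ae_abs_le (u : H2H10) : ∀ᵐ x ∂μI, |H2H10.toL2 u x| ≤ √Real.pi * ‖u‖ := by
  filter_upwards [ae_abs_le_of_mem_H10 u.2.1] with x hx
  refine hx.trans (mul_le_mul_of_nonneg_left ?_ (Real.sqrt_nonneg _))
  exact (WithLp.norm_snd_le _ _).trans (WithLp.norm_fst_le _ _)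

end Realization

/-! ### Superposition operators on `L²(0, π)` -/

section Nemytskii

theorem aestronglyMeasurable_comp {k : ℝ → ℝ → ℝ} (hk : Continuous fun z : ℝ × ℝ => k z.1 z.2)
    (u v : L2) : AEStronglyMeasurable (fun x => k (u x) (v x)) μI :=
  hk.comp_aestronglyMeasurable ((Lp.aestronglyMeasurable u).prodMk (Lp.aestronglyMeasurable v))

/-- Bounded, globally Lipschitz functions of two real variables. -/
structure IsBddLip (g : ℝ → ℝ → ℝ) : Prop where
  bdd : ∃ M, 0 ≤ M ∧ ∀ a b, |g a b| ≤ M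
  lip : ∃ K, 0 ≤ K ∧ ∀ a b a' b', |g a b - g a' b'| ≤ K * (|a - a'| + |b - b'|)

namespace IsBddLip

variable {g g' : ℝ → ℝ → ℝ}

theorem continuous (hg : IsBddLip g) : Continuous fun z : ℝ × ℝ => g z.1 z.2 := by
  obtain ⟨K, hK0, hK⟩ := hg.lip
  refine (LipschitzWith.of_dist_le_mul (K := ⟨2 * K, by positivity⟩) fun z z' => ?_).continuous
  refine (hK z.1 z.2 z'.1 z'.2).trans ?_
  have h1 : |z.1 - z'.1| ≤ dist z z' := le_max_left (dist z.1 z'.1) (dist z.2 z'.2)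
  have h2 : |z.2 - z'.2| ≤ dist z z' := le_max_right (dist z.1 z'.1) (dist z.2 z'.2)
  change _ ≤ 2 * K * dist z z'
  nlinarith

theorem add (hg : IsBddLip g) (hg' : IsBddLip g') : IsBddLip fun a b => g a b + g' a b := by
  obtain ⟨M, hM0, hM⟩ := hg.bdd
  obtain ⟨M', hM0', hM'⟩ := hg'.bdd
  obtain ⟨K, hK0, hK⟩ := hg.lip
  obtain ⟨K', hK0', hK'⟩ := hg'.lip
  refine ⟨⟨M + M', by positivity, fun a b => (abs_add_le _ _).trans (add_le_add (hM a b) (hM' a b))⟩,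
    ⟨K + K', by positivity, fun a b a' b' => ?_⟩⟩
  rw [add_sub_add_comm, add_mul]
  exact (abs_add_le _ _).trans (add_le_add (hK _ _ _ _) (hK' _ _ _ _))

theorem mul (hg : IsBddLip g) (hg' : IsBddLip g') : IsBddLip fun a b => g a b * g' a b := by
  obtain ⟨M, hM0, hM⟩ := hg.bdd
  obtain ⟨M', hM0', hM'⟩ := hg'.bdd
  obtain ⟨K, hK0, hK⟩ := hg.lip
  obtain ⟨K', hK0', hK'⟩ := hg'.lip
  refine ⟨⟨M * M', by positivity, fun a b => ?_⟩, ⟨M * K' + M' * K, by positivity,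
    fun a b a' b' => ?_⟩⟩
  · rw [abs_mul]
    exact mul_le_mul (hM a b) (hM' a b) (abs_nonneg _) hM0
  · have e : g a b * g' a b - g a' b' * g' a' b'
        = g a b * (g' a b - g' a' b') + g' a' b' * (g a b - g a' b') := by ring
    rw [e]
    refine (abs_add_le _ _).trans ?_
    rw [abs_mul, abs_mul, add_mul, mul_assoc, mul_assoc]
    exact add_le_add (mul_le_mul (hM a b) (hK' _ _ _ _) (abs_nonneg _) hM0)
      (mul_le_mul (hM' _ _) (hK _ _ _ _) (abs_nonneg _) hM0')

theorem const (c : ℝ) : IsBddLip fun _ _ => c :=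
  ⟨⟨|c|, abs_nonneg _, fun _ _ => le_rfl⟩, ⟨0, le_rfl, fun _ _ _ _ => by simp⟩⟩

theorem sub (hg : IsBddLip g) (hg' : IsBddLip g') : IsBddLip fun a b => g a b - g' a b := by
  simpa only [neg_one_mul, ← sub_eq_add_neg] using hg.add ((const (-1)).mul hg')

theorem cos_snd : IsBddLip fun _ b => Real.cos b :=
  ⟨⟨1, zero_le_one, fun _ b => Real.abs_cos_le_one b⟩, ⟨1, zero_le_one, fun a b a' b' => by
    have := Real.lipschitzWith_cos.dist_le_mul b b'
    rw [Real.dist_eq, Real.dist_eq, NNReal.coe_one] at this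
    linarith [abs_nonneg (a - a')]⟩⟩

theorem comp_add_sin {h : ℝ → ℝ} (hb : ∃ M, ∀ s, |h s| ≤ M)
    (hl : ∃ K, 0 ≤ K ∧ ∀ s t, |h s - h t| ≤ K * |s - t|) (c : ℝ) :
    IsBddLip fun a b => h (a + c * Real.sin b) := by
  obtain ⟨M, hM⟩ := hb
  obtain ⟨K, hK0, hK⟩ := hl
  refine ⟨⟨M, (abs_nonneg _).trans (hM 0), fun a b => hM _⟩, ⟨K * (1 + |c|), by positivity,
    fun a b a' b' => (hK _ _).trans ?_⟩⟩
  rw [mul_assoc]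
  refine mul_le_mul_of_nonneg_left ?_ hK0
  have h1 := Real.lipschitzWith_sin.dist_le_mul b b'
  rw [Real.dist_eq, Real.dist_eq, NNReal.coe_one, one_mul] at h1
  have e : a + c * Real.sin b - (a' + c * Real.sin b')
      = (a - a') + c * (Real.sin b - Real.sin b') := by ring
  rw [e]
  refine (abs_add_le _ _).trans ?_
  rw [abs_mul]
  have h2 := mul_le_mul_of_nonneg_left h1 (abs_nonneg c)
  nlinarith [abs_nonneg c, abs_nonneg (a - a'), abs_nonneg (b - b'),
    mul_nonneg (abs_nonneg c) (abs_nonneg (a - a'))]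

theorem memLp (hg : IsBddLip g) (u v : L2) : MemLp (fun x => g (u x) (v x)) 2 μI := by
  obtain ⟨M, _, hM⟩ := hg.bdd
  exact MemLp.of_bound (aestronglyMeasurable_comp hg.continuous u v) M
    (Filter.Eventually.of_forall fun x => hM _ _)

/-- The superposition operator `(u, v) ↦ g(u, v)` on `L²(0, π)`. -/
def op (hg : IsBddLip g) (u v : L2) : L2 := (hg.memLp u v).toLp _

theorem coeFn_op (hg : IsBddLip g) (u v : L2) : hg.op u v =ᵐ[μI] fun x => g (u x) (v x) :=
  MemLp.coeFn_toLp _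

theorem exists_norm_op_le (hg : IsBddLip g) : ∃ M, 0 ≤ M ∧ ∀ u v, ‖hg.op u v‖ ≤ M := by
  obtain ⟨M, hM0, hM⟩ := hg.bdd
  refine ⟨‖ofCont (fun _ => M) continuous_const‖, norm_nonneg _, fun u v => ?_⟩
  refine Lp.norm_le_norm_of_ae_le ?_
  filter_upwards [hg.coeFn_op u v, coeFn_ofCont (fun _ => M) continuous_const] with x h1 h2
  rw [h1, h2, Real.norm_eq_abs, Real.norm_of_nonneg hM0]
  exact hM _ _

theorem exists_norm_op_sub_le (hg : IsBddLip g) : ∃ K, 0 ≤ K ∧ ∀ u v u' v',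
    ‖hg.op u v - hg.op u' v'‖ ≤ K * (‖u - u'‖ + ‖v - v'‖) := by
  obtain ⟨K, hK0, hK⟩ := hg.lip
  refine ⟨K, hK0, fun u v u' v' => ?_⟩
  have h : ‖hg.op u v - hg.op u' v'‖ ≤ ‖K • (|u - u'| + |v - v'|)‖ := by
    refine Lp.norm_le_norm_of_ae_le ?_
    filter_upwards [hg.coeFn_op u v, hg.coeFn_op u' v', Lp.coeFn_sub (hg.op u v) (hg.op u' v'),
      Lp.coeFn_smul K (|u - u'| + |v - v'|), Lp.coeFn_add |u - u'| |v - v'|,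
      Lp.coeFn_abs (u - u'), Lp.coeFn_abs (v - v'), Lp.coeFn_sub u u', Lp.coeFn_sub v v']
      with x h1 h2 h3 h4 h5 h6 h7 h8 h9
    rw [h3, Pi.sub_apply, h1, h2, h4, Pi.smul_apply, h5, Pi.add_apply, h6, h7, h8, h9,
      Pi.sub_apply, Pi.sub_apply, smul_eq_mul, Real.norm_eq_abs, Real.norm_of_nonneg (by positivity)]
    exact hK _ _ _ _
  refine h.trans ?_
  rw [norm_smul, Real.norm_of_nonneg hK0]
  refine mul_le_mul_of_nonneg_left ((norm_add_le _ _).trans ?_) hK0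
  rw [norm_abs_eq_norm, norm_abs_eq_norm]

theorem continuous_op (hg : IsBddLip g) : Continuous fun z : L2 × L2 => hg.op z.1 z.2 := by
  obtain ⟨K, hK0, hK⟩ := hg.exists_norm_op_sub_le
  refine (LipschitzWith.of_dist_le_mul (K := ⟨2 * K, by positivity⟩) fun z z' => ?_).continuous
  rw [dist_eq_norm]
  refine (hK z.1 z.2 z'.1 z'.2).trans ?_
  have h1 : ‖z.1 - z'.1‖ ≤ dist z z' := by rw [← dist_eq_norm]; exact le_max_left _ _
  have h2 : ‖z.2 - z'.2‖ ≤ dist z z' := by rw [← dist_eq_norm]; exact le_max_right _ _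
  change _ ≤ 2 * K * dist z z'
  nlinarith

theorem inner_op (hg : IsBddLip g) (u v φ : L2) :
    inner ℝ (hg.op u v) φ = ∫ x, g (u x) (v x) * φ x ∂μI := by
  rw [inner_eq_integral]
  refine integral_congr_ae ?_
  filter_upwards [hg.coeFn_op u v] with x hx
  rw [hx]

end IsBddLip

/-- A functional `∫ k(u, v)` is differentiable on `L² × L²` if `k` has gradient `(g₁, g₂)` with a
quadratic remainder. -/
theorem hasDerivAt_integral_comp {k g₁ g₂ : ℝ → ℝ → ℝ} (hg₁ : IsBddLip g₁) (hg₂ : IsBddLip g₂)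
    (hk : ∀ u v : L2, Integrable (fun x => k (u x) (v x)) μI) {C : ℝ} (hC0 : 0 ≤ C)
    (hC : ∀ a b a' b', |k a' b' - k a b - (g₁ a b * (a' - a) + g₂ a b * (b' - b))|
      ≤ C * ((a' - a) ^ 2 + (b' - b) ^ 2))
    {u v : ℝ → L2} {u' v' : L2} {t : ℝ} (hu : HasDerivAt u u' t) (hv : HasDerivAt v v' t) :
    HasDerivAt (fun t => ∫ x, k (u t x) (v t x) ∂μI)
      (inner ℝ (hg₁.op (u t) (v t)) u' + inner ℝ (hg₂.op (u t) (v t)) v') t := by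
  set Ψ : L2 × L2 → ℝ := fun z => ∫ x, k (z.1 x) (z.2 x) ∂μI with hΨ
  have hint : ∀ w w' : L2, Integrable (fun x => w x * w' x) μI := fun w w' =>
    MemLp.integrable_mul (p := 2) (q := 2) (Lp.memLp w) (Lp.memLp w')
  have key : ∀ z d : L2 × L2, |Ψ (z + d) - Ψ z
      - (inner ℝ (hg₁.op z.1 z.2) d.1 + inner ℝ (hg₂.op z.1 z.2) d.2)| ≤ 2 * C * ‖d‖ ^ 2 := by
    intro z d
    have hsq : ∫ x, C * (d.1 x * d.1 x + d.2 x * d.2 x) ∂μI = C * (‖d.1‖ ^ 2 + ‖d.2‖ ^ 2) := by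
      rw [integral_const_mul, integral_add (hint _ _) (hint _ _), ← inner_eq_integral,
        ← inner_eq_integral, real_inner_self_eq_norm_sq, real_inner_self_eq_norm_sq]
    have h1 : ‖d.1‖ ≤ ‖d‖ := norm_fst_le d
    have h2 : ‖d.2‖ ≤ ‖d‖ := norm_snd_le d
    have hle : C * (‖d.1‖ ^ 2 + ‖d.2‖ ^ 2) ≤ 2 * C * ‖d‖ ^ 2 := by
      have h1' := pow_le_pow_left₀ (norm_nonneg _) h1 2
      have h2' := pow_le_pow_left₀ (norm_nonneg _) h2 2
      nlinarith
    refine le_trans ?_ hle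
    have hI₁ : Integrable (fun x => k ((z + d).1 x) ((z + d).2 x) - k (z.1 x) (z.2 x)) μI :=
      (hk _ _).sub (hk _ _)
    have hI₂ : Integrable (fun x => hg₁.op z.1 z.2 x * d.1 x + hg₂.op z.1 z.2 x * d.2 x) μI :=
      (hint _ _).add (hint _ _)
    rw [← hsq, inner_eq_integral, inner_eq_integral, ← integral_add (hint _ _) (hint _ _), hΨ,
      ← integral_sub (hk _ _) (hk _ _), ← integral_sub hI₁ hI₂, ← Real.norm_eq_abs]
    refine norm_integral_le_of_norm_le (((hint _ _).add (hint _ _)).const_mul C) ?_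
    filter_upwards [hg₁.coeFn_op z.1 z.2, hg₂.coeFn_op z.1 z.2, Lp.coeFn_add z.1 d.1,
      Lp.coeFn_add z.2 d.2] with x h1 h2 h3 h4
    rw [h1, h2, Prod.fst_add, Prod.snd_add, h3, h4, Real.norm_eq_abs]
    have := hC (z.1 x) (z.2 x) (z.1 x + d.1 x) (z.2 x + d.2 x)
    simpa only [add_sub_cancel_left, sq, Pi.add_apply] using this
  set L : L2 × L2 →L[ℝ] ℝ :=
    (innerSL ℝ (hg₁.op (u t) (v t))).comp (ContinuousLinearMap.fst ℝ L2 L2)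
      + (innerSL ℝ (hg₂.op (u t) (v t))).comp (ContinuousLinearMap.snd ℝ L2 L2) with hL
  have hF : HasFDerivAt Ψ L (u t, v t) := by
    rw [hasFDerivAt_iff_isLittleO_nhds_zero]
    refine Asymptotics.IsBigO.trans_isLittleO (g := fun d : L2 × L2 => ‖d‖ ^ 2) ?_
      (Asymptotics.isLittleO_norm_pow_id one_lt_two)
    refine Asymptotics.IsBigO.of_bound (2 * C) (Filter.Eventually.of_forall fun d => ?_)
    rw [norm_pow, norm_norm]
    exact key (u t, v t) d
  exact hF.comp_hasDerivAt t (hu.prodMk hv)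

end Nemytskii

/-! ### Truncation of `f` and the potential energy -/

section Nonlinearity

/-- Bounded, globally Lipschitz, nondecreasing functions that vanish at `0`. -/
structure IsTamed (h : ℝ → ℝ) : Prop where
  bdd : ∃ M, ∀ s, |h s| ≤ M
  lip : ∃ K, 0 ≤ K ∧ ∀ s t, |h s - h t| ≤ K * |s - t|
  mono : Monotone h
  zero : h 0 = 0

/-- The function `f` on `[-R, R]`, extended by constants. -/
def truncate (f : ℝ → ℝ) (R s : ℝ) : ℝ := f (max (-R) (min R s))

theorem truncate_of_abs_le (f : ℝ → ℝ) {R s : ℝ} (hs : |s| ≤ R) : truncate f R s = f s := by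
  rw [truncate, min_eq_right (abs_le.1 hs).2, max_eq_right (abs_le.1 hs).1]

theorem isTamed_truncate {f : ℝ → ℝ} (hf_lip : LocallyLipschitz f) (hf_mono : Monotone f)
    (hf_zero : f 0 = 0) {R : ℝ} (hR : 0 ≤ R) : IsTamed (truncate f R) := by
  have hmem : ∀ s, max (-R) (min R s) ∈ Icc (-R) R := fun s =>
    ⟨le_max_left _ _, max_le (by linarith) (min_le_left _ _)⟩
  have hmono : Monotone fun s => max (-R) (min R s) := fun s t hst => by
    dsimp only
    gcongr
  refine ⟨?_, ?_, hf_mono.comp hmono, ?_⟩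
  · obtain ⟨M, hM⟩ := (isCompact_Icc (a := -R) (b := R)).exists_bound_of_continuousOn
      hf_lip.continuous.continuousOn
    exact ⟨M, fun s => hM _ (hmem s)⟩
  · obtain ⟨K, hK⟩ := (hf_lip.locallyLipschitzOn (s := Icc (-R) R)).exists_lipschitzOnWith_of_compact
      isCompact_Icc
    refine ⟨K, K.2, fun s t => ?_⟩
    have h1 := hK.dist_le_mul _ (hmem s) _ (hmem t)
    rw [Real.dist_eq, Real.dist_eq] at h1
    refine h1.trans (mul_le_mul_of_nonneg_left ?_ K.2)
    refine (abs_max_sub_max_le_max _ _ _ _).trans ?_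
    rw [sub_self, abs_zero]
    refine max_le (abs_nonneg _) ((abs_min_sub_min_le_max _ _ _ _).trans ?_)
    rw [sub_self, abs_zero]
    exact max_le (abs_nonneg _) le_rfl
  · rw [truncate_of_abs_le f (by rwa [abs_zero]), hf_zero]

/-- The nonlinear term of the equation for `y`. -/
def force (ℓ : ℝ) (h : ℝ → ℝ) (a b : ℝ) : ℝ :=
  h (a - ℓ * Real.sin b) + h (a + ℓ * Real.sin b)

/-- The nonlinear term of the equation for `θ`, up to the factor `3`. -/
def torque (ℓ : ℝ) (h : ℝ → ℝ) (a b : ℝ) : ℝ :=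
  Real.cos b * (h (a + ℓ * Real.sin b) - h (a - ℓ * Real.sin b))

variable {ℓ : ℝ} {h : ℝ → ℝ}

theorem IsTamed.isBddLip_add (hh : IsTamed h) (ℓ : ℝ) :
    IsBddLip fun a b => h (a + ℓ * Real.sin b) :=
  IsBddLip.comp_add_sin hh.bdd hh.lip ℓ

theorem IsTamed.isBddLip_sub (hh : IsTamed h) (ℓ : ℝ) :
    IsBddLip fun a b => h (a - ℓ * Real.sin b) := by
  simpa only [neg_mul, ← sub_eq_add_neg] using hh.isBddLip_add (-ℓ)

theorem IsTamed.isBddLip_force (hh : IsTamed h) (ℓ : ℝ) : IsBddLip (force ℓ h) :=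
  (hh.isBddLip_sub ℓ).add (hh.isBddLip_add ℓ)

theorem IsTamed.isBddLip_torque (hh : IsTamed h) (ℓ c : ℝ) :
    IsBddLip fun a b => c * torque ℓ h a b :=
  (IsBddLip.const c).mul (IsBddLip.cos_snd.mul ((hh.isBddLip_add ℓ).sub (hh.isBddLip_sub ℓ)))

theorem IsTamed.continuous (hh : IsTamed h) : Continuous h := by
  obtain ⟨K, hK0, hK⟩ := hh.lip
  exact (LipschitzWith.of_dist_le_mul (K := ⟨K, hK0⟩) fun s t => hK s t).continuous

/-- The primitive of `h` that vanishes at `0`. -/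
def primitive (h : ℝ → ℝ) (s : ℝ) : ℝ := ∫ τ in (0 : ℝ)..s, h τ

theorem IsTamed.hasDerivAt_primitive (hh : IsTamed h) (s : ℝ) :
    HasDerivAt (primitive h) (h s) s :=
  intervalIntegral.integral_hasDerivAt_right (hh.continuous.intervalIntegrable _ _)
    (hh.continuous.stronglyMeasurableAtFilter _ _) hh.continuous.continuousAt

theorem IsTamed.primitive_nonneg (hh : IsTamed h) (s : ℝ) : 0 ≤ primitive h s := by
  rcases le_total 0 s with hs | hs
  · exact intervalIntegral.integral_nonneg hs fun τ hτ => hh.zero ▸ hh.mono hτ.1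
  · rw [primitive, intervalIntegral.integral_symm, ← intervalIntegral.integral_neg]
    refine intervalIntegral.integral_nonneg hs fun τ hτ => ?_
    have := hh.mono hτ.2
    rw [hh.zero] at this
    linarith

theorem abs_primitive_le {M s : ℝ} (hM : ∀ τ, |τ| ≤ |s| → |h τ| ≤ M) :
    |primitive h s| ≤ M * |s| := by
  have := intervalIntegral.norm_integral_le_of_norm_le_const (f := h) (a := 0) (b := s) (C := M)
    fun τ hτ => hM τ (by
      rcases le_total 0 s with hs | hs
      · rw [uIoc_of_le hs] at hτ
        rw [abs_of_pos hτ.1, abs_of_nonneg hs]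
        exact hτ.2
      · rw [uIoc_of_ge hs] at hτ
        rw [abs_of_nonpos hτ.2, abs_of_nonpos hs]
        linarith [hτ.1])
  rwa [sub_zero] at this

/-- The density of the potential energy. -/
def potential (ℓ : ℝ) (h : ℝ → ℝ) (a b : ℝ) : ℝ :=
  primitive h (a - ℓ * Real.sin b) + primitive h (a + ℓ * Real.sin b)

theorem IsTamed.potential_nonneg (hh : IsTamed h) (ℓ a b : ℝ) : 0 ≤ potential ℓ h a b :=
  add_nonneg (hh.primitive_nonneg _) (hh.primitive_nonneg _)

theorem abs_sin_mul_le (ℓ b : ℝ) : |ℓ * Real.sin b| ≤ |ℓ| := by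
  rw [abs_mul]
  exact mul_le_of_le_one_right (abs_nonneg _) (Real.abs_sin_le_one b)

theorem abs_add_sin_le (ℓ a b : ℝ) :
    |a - ℓ * Real.sin b| ≤ |a| + |ℓ| ∧ |a + ℓ * Real.sin b| ≤ |a| + |ℓ| := by
  have := abs_sin_mul_le ℓ b
  exact ⟨(abs_sub _ _).trans (by linarith), (abs_add_le _ _).trans (by linarith)⟩

theorem abs_potential_le {M a b : ℝ} (hM0 : 0 ≤ M) (hM : ∀ τ, |τ| ≤ |a| + |ℓ| → |h τ| ≤ M) :
    |potential ℓ h a b| ≤ 2 * M * (|a| + |ℓ|) := by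
  obtain ⟨h1, h2⟩ := abs_add_sin_le ℓ a b
  have h3 := abs_primitive_le (h := h) (M := M) fun τ hτ => hM τ (hτ.trans h1)
  have h4 := abs_primitive_le (h := h) (M := M) fun τ hτ => hM τ (hτ.trans h2)
  refine (abs_add_le _ _).trans ?_
  nlinarith

theorem IsTamed.integrable_potential (hh : IsTamed h) (ℓ : ℝ) (u v : L2) :
    Integrable (fun x => potential ℓ h (u x) (v x)) μI := by
  obtain ⟨M, hM⟩ := hh.bdd
  have hM0 : 0 ≤ M := (abs_nonneg _).trans (hM 0)
  have hp : Continuous (primitive h) :=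
    continuous_iff_continuousAt.2 fun s => (hh.hasDerivAt_primitive s).continuousAt
  have hc : Continuous fun z : ℝ × ℝ => potential ℓ h z.1 z.2 := by
    unfold potential
    fun_prop
  have hu : Integrable (fun x => u x) μI := (Lp.memLp u).integrable (by norm_num)
  have hpot := aestronglyMeasurable_comp hc u v
  have hg : Integrable (fun x => 2 * M * (|u x| + |ℓ|)) μI :=
    (hu.abs.add (integrable_const |ℓ|)).const_mul (2 * M)
  refine hg.mono' hpot (Filter.Eventually.of_forall fun x => ?_)
  exact abs_potential_le hM0 fun τ _ => hM τ

/-- A function whose gradient is Lipschitz is approximated by its differential up to a quadratic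
remainder. -/
theorem IsBddLip.exists_taylor {k g₁ g₂ : ℝ → ℝ → ℝ} (hg₁ : IsBddLip g₁) (hg₂ : IsBddLip g₂)
    (hd : ∀ a b δ ε τ : ℝ, HasDerivAt (fun τ => k (a + τ * δ) (b + τ * ε))
      (g₁ (a + τ * δ) (b + τ * ε) * δ + g₂ (a + τ * δ) (b + τ * ε) * ε) τ) :
    ∃ C, 0 ≤ C ∧ ∀ a b a' b', |k a' b' - k a b - (g₁ a b * (a' - a) + g₂ a b * (b' - b))|
      ≤ C * ((a' - a) ^ 2 + (b' - b) ^ 2) := by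
  obtain ⟨K₁, hK₁0, hK₁⟩ := hg₁.lip
  obtain ⟨K₂, hK₂0, hK₂⟩ := hg₂.lip
  refine ⟨2 * (K₁ + K₂), by positivity, fun a b a' b' => ?_⟩
  obtain ⟨δ, rfl⟩ : ∃ δ, a' = a + δ := ⟨a' - a, by ring⟩
  obtain ⟨ε, rfl⟩ : ∃ ε, b' = b + ε := ⟨b' - b, by ring⟩
  rw [add_sub_cancel_left, add_sub_cancel_left]
  have hd' : ∀ τ, HasDerivAt
      (fun τ => k (a + τ * δ) (b + τ * ε) - τ * (g₁ a b * δ + g₂ a b * ε))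
      (g₁ (a + τ * δ) (b + τ * ε) * δ + g₂ (a + τ * δ) (b + τ * ε) * ε
        - (g₁ a b * δ + g₂ a b * ε)) τ := fun τ => by
    have := (hasDerivAt_id τ).mul_const (g₁ a b * δ + g₂ a b * ε)
    rw [one_mul] at this
    exact (hd a b δ ε τ).sub this
  have hbound : ∀ τ ∈ Ico (0 : ℝ) 1, ‖g₁ (a + τ * δ) (b + τ * ε) * δ
      + g₂ (a + τ * δ) (b + τ * ε) * ε - (g₁ a b * δ + g₂ a b * ε)‖
      ≤ 2 * (K₁ + K₂) * (δ ^ 2 + ε ^ 2) := by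
    intro τ hτ
    have h1 := hK₁ (a + τ * δ) (b + τ * ε) a b
    have h2 := hK₂ (a + τ * δ) (b + τ * ε) a b
    rw [add_sub_cancel_left, add_sub_cancel_left, abs_mul, abs_mul, abs_of_nonneg hτ.1,
      ← mul_add] at h1 h2
    obtain ⟨n, hn⟩ : ∃ n, n = |δ| + |ε| := ⟨_, rfl⟩
    rw [← hn] at h1 h2
    have hn0 : 0 ≤ n := by rw [hn]; positivity
    have h1' := h1.trans (mul_le_mul_of_nonneg_left (mul_le_of_le_one_left hn0 hτ.2.le) hK₁0)
    have h2' := h2.trans (mul_le_mul_of_nonneg_left (mul_le_of_le_one_left hn0 hτ.2.le) hK₂0)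
    have hδ : |δ| ≤ n := by rw [hn]; linarith [abs_nonneg ε]
    have hε : |ε| ≤ n := by rw [hn]; linarith [abs_nonneg δ]
    have hn2 : n * n ≤ 2 * (δ ^ 2 + ε ^ 2) := by
      rw [hn, ← sq_abs δ, ← sq_abs ε]
      linarith [sq_nonneg (|δ| - |ε|)]
    have e : g₁ (a + τ * δ) (b + τ * ε) * δ + g₂ (a + τ * δ) (b + τ * ε) * ε
        - (g₁ a b * δ + g₂ a b * ε)
        = (g₁ (a + τ * δ) (b + τ * ε) - g₁ a b) * δ
          + (g₂ (a + τ * δ) (b + τ * ε) - g₂ a b) * ε := by ring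
    rw [e, Real.norm_eq_abs]
    refine (abs_add_le _ _).trans ?_
    rw [abs_mul, abs_mul]
    have h3 := mul_le_mul h1' hδ (abs_nonneg _) (by positivity)
    have h4 := mul_le_mul h2' hε (abs_nonneg _) (by positivity)
    have h5 := mul_le_mul_of_nonneg_left hn2 (add_nonneg hK₁0 hK₂0)
    linarith
  have := norm_image_sub_le_of_norm_deriv_le_segment_01' (fun τ _ => (hd' τ).hasDerivWithinAt)
    hbound
  simp only [one_mul, zero_mul, add_zero, sub_zero, Real.norm_eq_abs] at this
  rwa [sub_right_comm] at this

theorem IsTamed.hasDerivAt_potential (hh : IsTamed h) (ℓ a b δ ε τ : ℝ) :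
    HasDerivAt (fun τ => potential ℓ h (a + τ * δ) (b + τ * ε))
      (force ℓ h (a + τ * δ) (b + τ * ε) * δ + ℓ * torque ℓ h (a + τ * δ) (b + τ * ε) * ε) τ := by
  have h1 : HasDerivAt (fun τ : ℝ => a + τ * δ) δ τ := by
    simpa using ((hasDerivAt_id τ).mul_const δ).const_add a
  have h2 : HasDerivAt (fun τ : ℝ => b + τ * ε) ε τ := by
    simpa using ((hasDerivAt_id τ).mul_const ε).const_add b
  have h3 := (h2.sin).const_mul ℓ
  have h4 := (hh.hasDerivAt_primitive _).comp τ (h1.sub h3)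
  have h5 := (hh.hasDerivAt_primitive _).comp τ (h1.add h3)
  refine (h4.add h5).congr_deriv ?_
  simp only [force, torque, Pi.sub_apply, Pi.add_apply]
  ring

end Nonlinearity

/-! ### The free evolution -/

section Linear

/-- The operator `cos(tΛ)`. -/
def cosOp (lam : ℕ → ℝ) (t : ℝ) : L2 →L[ℝ] L2 :=
  diag sineBasis (fun n => Real.cos (lam n * t)) fun _ => Real.abs_cos_le_one _

/-- The operator `sin(tΛ)`. -/
def sinOp (lam : ℕ → ℝ) (t : ℝ) : L2 →L[ℝ] L2 :=
  diag sineBasis (fun n => Real.sin (lam n * t)) fun _ => Real.abs_sin_le_one _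

variable {lam : ℕ → ℝ}

@[simp]
theorem inner_cosOp (n : ℕ) (t : ℝ) (x : L2) :
    inner ℝ (sineL n) (cosOp lam t x) = Real.cos (lam n * t) * inner ℝ (sineL n) x := by
  rw [← coe_sineBasis, cosOp, inner_diag]

@[simp]
theorem inner_sinOp (n : ℕ) (t : ℝ) (x : L2) :
    inner ℝ (sineL n) (sinOp lam t x) = Real.sin (lam n * t) * inner ℝ (sineL n) x := by
  rw [← coe_sineBasis, sinOp, inner_diag]

theorem norm_cosOp_apply_le (t : ℝ) (x : L2) : ‖cosOp lam t x‖ ≤ ‖x‖ :=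
  norm_diag_apply_le _ _ _

theorem norm_sinOp_apply_le (t : ℝ) (x : L2) : ‖sinOp lam t x‖ ≤ ‖x‖ :=
  norm_diag_apply_le _ _ _

theorem inner_cosOp_left (t : ℝ) (x y : L2) :
    inner ℝ (cosOp lam t x) y = inner ℝ x (cosOp lam t y) :=
  inner_diag_left _ _ _ _

theorem inner_sinOp_left (t : ℝ) (x y : L2) :
    inner ℝ (sinOp lam t x) y = inner ℝ x (sinOp lam t y) :=
  inner_diag_left _ _ _ _

theorem ext_sineL {x y : L2} (h : ∀ n, inner ℝ (sineL n) x = inner ℝ (sineL n) y) : x = y :=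
  ext_coord sineBasis fun n => by rw [coe_sineBasis, h n]

theorem cosOp_zero (x : L2) : cosOp lam 0 x = x := ext_sineL fun n => by simp

theorem sinOp_zero (x : L2) : sinOp lam 0 x = 0 := ext_sineL fun n => by simp

theorem continuousOn_cosOp {S : Set ℝ} {γ : ℝ → L2} (hγ : ContinuousOn γ S) :
    ContinuousOn (fun t => cosOp lam t (γ t)) S :=
  continuous_diag_comp sineBasis _ (fun _ => by fun_prop) hγ

theorem continuousOn_sinOp {S : Set ℝ} {γ : ℝ → L2} (hγ : ContinuousOn γ S) :
    ContinuousOn (fun t => sinOp lam t (γ t)) S :=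
  continuous_diag_comp sineBasis _ (fun _ => by fun_prop) hγ

theorem cosOp_add_sinOp (t : ℝ) (x : L2) :
    cosOp lam t (cosOp lam t x) + sinOp lam t (sinOp lam t x) = x := by
  refine ext_sineL fun n => ?_
  simp only [inner_add_right, inner_cosOp, inner_sinOp]
  linear_combination inner ℝ (sineL n) x * Real.cos_sq_add_sin_sq (lam n * t)

theorem cosOp_sinOp (t : ℝ) (x : L2) :
    cosOp lam t (sinOp lam t x) = sinOp lam t (cosOp lam t x) := by
  refine ext_sineL fun n => ?_
  simp only [inner_cosOp, inner_sinOp]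
  ring

/-- The state `(Λ u, u_t)` at time `t` of the free evolution `u_tt + Λ² u = 0` started from `w`. -/
def rot (lam : ℕ → ℝ) (t : ℝ) (w : L2 × L2) : L2 × L2 :=
  (cosOp lam t w.1 + sinOp lam t w.2, cosOp lam t w.2 - sinOp lam t w.1)

/-- The image of `(0, -g)` under the free evolution from time `t` back to time `0`. -/
def kick (lam : ℕ → ℝ) (t : ℝ) (g : L2) : L2 × L2 := (sinOp lam t g, -cosOp lam t g)

theorem rot_zero (w : L2 × L2) : rot lam 0 w = w := by
  simp [rot, cosOp_zero, sinOp_zero]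

theorem norm_sq_rot (t : ℝ) (w : L2 × L2) :
    ‖(rot lam t w).1‖ ^ 2 + ‖(rot lam t w).2‖ ^ 2 = ‖w.1‖ ^ 2 + ‖w.2‖ ^ 2 := by
  have h1 : inner ℝ (cosOp lam t w.1) (cosOp lam t w.1)
      + inner ℝ (sinOp lam t w.1) (sinOp lam t w.1) = ‖w.1‖ ^ 2 := by
    rw [inner_cosOp_left, inner_sinOp_left, ← inner_add_right, cosOp_add_sinOp,
      real_inner_self_eq_norm_sq]
  have h2 : inner ℝ (cosOp lam t w.2) (cosOp lam t w.2)
      + inner ℝ (sinOp lam t w.2) (sinOp lam t w.2) = ‖w.2‖ ^ 2 := by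
    rw [inner_cosOp_left, inner_sinOp_left, ← inner_add_right, cosOp_add_sinOp,
      real_inner_self_eq_norm_sq]
  have h3 : inner ℝ (cosOp lam t w.1) (sinOp lam t w.2)
      = inner ℝ (sinOp lam t w.1) (cosOp lam t w.2) := by
    rw [inner_cosOp_left, inner_sinOp_left, cosOp_sinOp]
  rw [rot, ← real_inner_self_eq_norm_sq, ← real_inner_self_eq_norm_sq, real_inner_add_add_self,
    real_inner_sub_sub_self, h3, real_inner_comm (sinOp lam t w.1) (cosOp lam t w.2)]
  linarith

theorem norm_kick_sub_le (t : ℝ) (g g' : L2) : ‖kick lam t g - kick lam t g'‖ ≤ ‖g - g'‖ := by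
  rw [kick, kick, Prod.mk_sub_mk, ← map_sub, neg_sub_neg, ← map_sub]
  refine max_le (norm_sinOp_apply_le _ _) ((norm_cosOp_apply_le _ _).trans ?_)
  rw [norm_sub_rev]

theorem norm_kick_le (t : ℝ) (g : L2) : ‖kick lam t g‖ ≤ ‖g‖ :=
  max_le (norm_sinOp_apply_le _ _) ((norm_neg _).trans_le (norm_cosOp_apply_le _ _))

theorem norm_rot_fst_sub_le (t : ℝ) (w w' : L2 × L2) :
    ‖(rot lam t w).1 - (rot lam t w').1‖ ≤ 2 * ‖w - w'‖ := by
  have e : (rot lam t w).1 - (rot lam t w').1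
      = cosOp lam t (w - w').1 + sinOp lam t (w - w').2 := by
    simp only [rot, Prod.fst_sub, Prod.snd_sub, map_sub]
    abel
  rw [e]
  refine (norm_add_le _ _).trans ?_
  linarith [norm_cosOp_apply_le (lam := lam) t (w - w').1,
    norm_sinOp_apply_le (lam := lam) t (w - w').2, norm_fst_le (w - w'), norm_snd_le (w - w')]

theorem continuous_rot {w : ℝ → L2 × L2} {S : Set ℝ} (hw : ContinuousOn w S) :
    ContinuousOn (fun t => rot lam t (w t)) S :=
  ((continuousOn_cosOp hw.fst).add (continuousOn_sinOp hw.snd)).prodMk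
    ((continuousOn_cosOp hw.snd).sub (continuousOn_sinOp hw.fst))

theorem continuous_kick {g : ℝ → L2} {S : Set ℝ} (hg : ContinuousOn g S) :
    ContinuousOn (fun t => kick lam t (g t)) S :=
  (continuousOn_sinOp hg).prodMk (continuousOn_cosOp hg).neg

theorem hasDerivAt_cos_mul (c t : ℝ) :
    HasDerivAt (fun s => Real.cos (c * s)) (-(c * Real.sin (c * t))) t := by
  have h : HasDerivAt (fun s => c * s) c t := by simpa using (hasDerivAt_id t).const_mul c
  refine h.cos.congr_deriv ?_
  ring

theorem hasDerivAt_sin_mul (c t : ℝ) :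
    HasDerivAt (fun s => Real.sin (c * s)) (c * Real.cos (c * t)) t := by
  have h : HasDerivAt (fun s => c * s) c t := by simpa using (hasDerivAt_id t).const_mul c
  refine h.sin.congr_deriv ?_
  ring

theorem hasDerivAt_inner {γ : ℝ → L2} {γ' : L2} {t : ℝ} (h : HasDerivAt γ γ' t) (x : L2) :
    HasDerivAt (fun s => inner ℝ x (γ s)) (inner ℝ x γ') t :=
  (innerSL ℝ x).hasFDerivAt.comp_hasDerivAt t h

end Linear

/-! ### The forced linear equation in the interaction picture -/

section Component

variable {V : Type*} [NormedAddCommGroup V] [NormedSpace ℝ V] {lam : ℕ → ℝ} {ι B : V →L[ℝ] L2}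

/-- The dual `L² → V'` of a map `T : V → L²`. -/
def dualMap (T : V →L[ℝ] L2) : L2 →L[ℝ] StrongDual ℝ V :=
  LinearMap.mkContinuous
    { toFun := fun u => (innerSL ℝ u).comp T
      map_add' := fun u v => by ext φ; simp
      map_smul' := fun c u => by ext φ; simp } ‖T‖ fun u => by
    refine ((innerSL ℝ u).opNorm_comp_le T).trans ?_
    rw [innerSL_apply_norm, mul_comm]

theorem dualMap_apply (T : V →L[ℝ] L2) (u : L2) (φ : V) : dualMap T u φ = inner ℝ u (T φ) := rfl

namespace Realization

theorem lam_ne_zero (ρ : Realization V lam ι B) (n : ℕ) : lam n ≠ 0 :=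
  (zero_lt_one.trans_le (ρ.one_le n)).ne'

theorem P_D (ρ : Realization V lam ι B) (u : V) : ρ.P (ρ.D u) = u :=
  ρ.injective <| ext_sineL fun n => by
    rw [ρ.inner_P, ρ.inner_D, inv_mul_cancel_left₀ (ρ.lam_ne_zero n)]

theorem dualMap_inclusion (ρ : Realization V lam ι B) (x : L2) :
    dualMap ι x = dualMap ρ.D (ι (ρ.P x)) := by
  ext φ
  rw [dualMap_apply, dualMap_apply]
  refine (hasSum_coord_mul sineBasis _ _).unique ?_
  convert hasSum_coord_mul sineBasis (ι (ρ.P x)) (ρ.D φ) using 2 with n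
  rw [coe_sineBasis, ρ.inner_P, ρ.inner_D]
  field_simp [ρ.lam_ne_zero n]

/-- The position `u = Λ⁻¹ (Λ u)` at time `t`, for the state `w` in the interaction picture. -/
def pos (ρ : Realization V lam ι B) (t : ℝ) (w : L2 × L2) : L2 := ι (ρ.P (rot lam t w).1)

variable (ρ : Realization V lam ι B) {w : ℝ → L2 × L2} {g : ℝ → L2}

theorem continuous_pos {S : Set ℝ} (hw : ContinuousOn w S) :
    ContinuousOn (fun t => ρ.pos t (w t)) S :=
  (ι.continuous.comp ρ.P.continuous).comp_continuousOn (continuous_rot hw).fst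

theorem norm_pos_sub_le (t : ℝ) (w w' : L2 × L2) :
    ‖ρ.pos t w - ρ.pos t w'‖ ≤ ‖ι.comp ρ.P‖ * (2 * ‖w - w'‖) := by
  have e : ρ.pos t w - ρ.pos t w' = ι.comp ρ.P ((rot lam t w).1 - (rot lam t w').1) := by
    rw [map_sub]
    rfl
  rw [e]
  exact ((ι.comp ρ.P).le_opNorm _).trans
    (mul_le_mul_of_nonneg_left (norm_rot_fst_sub_le t w w') (norm_nonneg _))

theorem continuous_of_kick (hw : ∀ t, HasDerivAt w (kick lam t (g t)) t) : Continuous w :=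
  continuous_iff_continuousAt.2 fun t => (hw t).continuousAt

theorem continuous_rot_of_kick (hw : ∀ t, HasDerivAt w (kick lam t (g t)) t) :
    Continuous fun t => rot lam t (w t) :=
  continuousOn_univ.1 (continuous_rot (continuous_of_kick hw).continuousOn)

/-- In the interaction picture `u_t` is the second component of the state. -/
theorem hasDerivAt_pos (hw : ∀ t, HasDerivAt w (kick lam t (g t)) t) (t : ℝ) :
    HasDerivAt (fun t => ρ.pos t (w t)) (rot lam t (w t)).2 t := by
  refine hasDerivAt_of_coord sineBasis (v := fun t => (rot lam t (w t)).2)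
    (continuous_rot_of_kick hw).snd (fun n t => ?_) t
  have h1 := hasDerivAt_inner (hw t).fst (sineL n)
  have h2 := hasDerivAt_inner (hw t).snd (sineL n)
  have h3 := (((hasDerivAt_cos_mul (lam n) t).mul h1).add
    ((hasDerivAt_sin_mul (lam n) t).mul h2)).const_mul (lam n)⁻¹
  simp only [coe_sineBasis, pos, ρ.inner_P, rot, inner_add_right, inner_sub_right, inner_cosOp,
    inner_sinOp]
  refine h3.congr_deriv ?_
  have := ρ.lam_ne_zero n
  simp only [kick, inner_neg_right, inner_cosOp, inner_sinOp]
  field_simp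
  ring

/-- The equation `Λ⁻¹ u_tt = - Λ u - Λ⁻¹ g`. -/
theorem hasDerivAt_inv_velocity (hw : ∀ t, HasDerivAt w (kick lam t (g t)) t)
    (hg : Continuous g) (t : ℝ) :
    HasDerivAt (fun t => ι (ρ.P (rot lam t (w t)).2))
      (-(rot lam t (w t)).1 - ι (ρ.P (g t))) t := by
  refine hasDerivAt_of_coord sineBasis (v := fun t => -(rot lam t (w t)).1 - ι (ρ.P (g t)))
    ((continuous_rot_of_kick hw).fst.neg.sub (by fun_prop)) (fun n t => ?_) t
  have h1 := hasDerivAt_inner (hw t).fst (sineL n)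
  have h2 := hasDerivAt_inner (hw t).snd (sineL n)
  have h3 := (((hasDerivAt_cos_mul (lam n) t).mul h2).sub
    ((hasDerivAt_sin_mul (lam n) t).mul h1)).const_mul (lam n)⁻¹
  simp only [coe_sineBasis, ρ.inner_P, rot, inner_add_right, inner_sub_right, inner_cosOp,
    inner_sinOp, inner_neg_right]
  refine h3.congr_deriv ?_
  have := ρ.lam_ne_zero n
  have hcs := Real.cos_sq_add_sin_sq (lam n * t)
  simp only [kick, inner_neg_right, inner_cosOp, inner_sinOp]
  field_simp
  linear_combination (-inner ℝ (sineL n) (g t)) * hcs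

end Realization

theorem iteratedDerivWithin_two_eq {F : Type*} [NormedAddCommGroup F] [NormedSpace ℝ F]
    {γ γ₁ γ₂ : ℝ → F} (h1 : ∀ t, HasDerivAt γ (γ₁ t) t) (h2 : ∀ t, HasDerivAt γ₁ (γ₂ t) t)
    (hc : Continuous γ₂) : ContDiff ℝ 2 γ ∧
      ∀ t, 0 ≤ t → iteratedDerivWithin 2 γ (Ici 0) t = γ₂ t := by
  have e1 : deriv γ = γ₁ := funext fun t => (h1 t).deriv
  have e2 : deriv γ₁ = γ₂ := funext fun t => (h2 t).deriv
  have c1 : ContDiff ℝ 1 γ₁ :=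
    contDiff_one_iff_deriv.2 ⟨fun t => (h2 t).differentiableAt, e2 ▸ hc⟩
  have c2 : ContDiff ℝ 2 γ := by
    have : ContDiff ℝ (1 + 1) γ := contDiff_succ_iff_deriv.2
      ⟨fun t => (h1 t).differentiableAt, by simp, e1 ▸ c1⟩
    simpa [one_add_one_eq_two] using this
  refine ⟨c2, fun t ht => ?_⟩
  rw [iteratedDerivWithin_eq_iteratedDeriv (uniqueDiffOn_Ici 0) c2.contDiffAt ht,
    iteratedDeriv_succ, iteratedDeriv_one, e1, e2]

namespace Realization

variable (ρ : Realization V lam ι B) {w : ℝ → L2 × L2} {g : ℝ → L2}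

/-- A curve in the interaction picture gives a weak solution of `u_tt + Λ² u + g = 0`. -/
theorem weak_solution_of_kick (hg : Continuous g) (hw : ∀ t, HasDerivAt w (kick lam t (g t)) t) :
    ContDiff ℝ 1 (fun t => ρ.pos t (w t)) ∧ ContDiff ℝ 2 (fun t => dualMap ι (ρ.pos t (w t))) ∧
    ∀ t, 0 ≤ t → ∀ φ : V,
      iteratedDerivWithin 2 (fun s => dualMap ι (ρ.pos s (w s))) (Ici 0) t φ
        + inner ℝ (B (ρ.P (rot lam t (w t)).1)) (B φ) + inner ℝ (g t) (ι φ) = 0 := by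
  have hd := ρ.hasDerivAt_pos hw
  have hc := continuous_rot_of_kick hw
  have h1 : ∀ t, HasDerivAt (fun t => dualMap ι (ρ.pos t (w t)))
      (dualMap ρ.D (ι (ρ.P (rot lam t (w t)).2))) t := fun t => by
    rw [← ρ.dualMap_inclusion]
    exact (dualMap ι).hasFDerivAt.comp_hasDerivAt t (hd t)
  have h2 : ∀ t, HasDerivAt (fun t => dualMap ρ.D (ι (ρ.P (rot lam t (w t)).2)))
      (dualMap ρ.D (-(rot lam t (w t)).1 - ι (ρ.P (g t)))) t := fun t =>
    (dualMap ρ.D).hasFDerivAt.comp_hasDerivAt t (ρ.hasDerivAt_inv_velocity hw hg t)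
  obtain ⟨h3, h4⟩ := iteratedDerivWithin_two_eq h1 h2
    ((dualMap ρ.D).continuous.comp (hc.fst.neg.sub (by fun_prop)))
  refine ⟨contDiff_one_iff_deriv.2 ⟨fun t => (hd t).differentiableAt, ?_⟩, h3, fun t ht φ => ?_⟩
  · rw [funext fun t => (hd t).deriv]
    exact hc.snd
  · rw [h4 t ht, map_sub, map_neg, ← ρ.dualMap_inclusion, ρ.inner_B_P, sub_apply, neg_apply,
      dualMap_apply, dualMap_apply]
    ring

end Realization

end Component

/-! ### The truncated system and its energy -/

section Energy

theorem hasDerivAt_norm_sq_of_kick {lam : ℕ → ℝ} {w : ℝ → L2 × L2} {g : L2} {t : ℝ}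
    (hw : HasDerivAt w (kick lam t g) t) :
    HasDerivAt (fun t => ‖(w t).1‖ ^ 2 + ‖(w t).2‖ ^ 2)
      (-2 * inner ℝ g (rot lam t (w t)).2) t := by
  have h1 : HasDerivAt (fun t => (w t).1) (kick lam t g).1 t := hw.fst
  have h2 : HasDerivAt (fun t => (w t).2) (kick lam t g).2 t := hw.snd
  refine (h1.norm_sq.add h2.norm_sq).congr_deriv ?_
  rw [rot, inner_sub_right, ← inner_cosOp_left, ← inner_sinOp_left, kick, inner_neg_right,
    real_inner_comm, real_inner_comm (cosOp lam t g)]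
  ring

variable {V V' : Type*} [NormedAddCommGroup V] [NormedSpace ℝ V] [NormedAddCommGroup V']
  [NormedSpace ℝ V'] {lam lam' : ℕ → ℝ} {ι B : V →L[ℝ] L2} {ι' B' : V' →L[ℝ] L2}

open scoped NNReal

/-- The vector field of the coupled system in the interaction picture. -/
def vectorField (ρ : Realization V lam ι B) (ρ' : Realization V' lam' ι' B') {g g' : ℝ → ℝ → ℝ}
    (hg : IsBddLip g) (hg' : IsBddLip g') (t : ℝ) (w : (L2 × L2) × (L2 × L2)) :
    (L2 × L2) × (L2 × L2) :=
  (kick lam t (hg.op (ρ.pos t w.1) (ρ'.pos t w.2)),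
    kick lam' t (hg'.op (ρ.pos t w.1) (ρ'.pos t w.2)))

theorem exists_lipschitzWith_vectorField (ρ : Realization V lam ι B) (ρ' : Realization V' lam' ι' B')
    {g g' : ℝ → ℝ → ℝ} (hg : IsBddLip g) (hg' : IsBddLip g') :
    ∃ K : ℝ≥0, ∀ t, LipschitzWith K (vectorField ρ ρ' hg hg' t) := by
  have key : ∀ (g : ℝ → ℝ → ℝ) (hg : IsBddLip g), ∃ K, 0 ≤ K ∧
      ∀ t (w z : (L2 × L2) × (L2 × L2)), ‖hg.op (ρ.pos t w.1) (ρ'.pos t w.2)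
        - hg.op (ρ.pos t z.1) (ρ'.pos t z.2)‖ ≤ K * ‖w - z‖ := by
    intro g hg
    obtain ⟨K, hK0, hK⟩ := hg.exists_norm_op_sub_le
    refine ⟨K * (‖ι.comp ρ.P‖ * 2 + ‖ι'.comp ρ'.P‖ * 2), by positivity, fun t w z => ?_⟩
    refine (hK _ _ _ _).trans ?_
    rw [mul_assoc]
    refine mul_le_mul_of_nonneg_left ?_ hK0
    rw [add_mul, mul_assoc, mul_assoc]
    refine add_le_add ((ρ.norm_pos_sub_le t _ _).trans ?_) ((ρ'.norm_pos_sub_le t _ _).trans ?_)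
    · exact mul_le_mul_of_nonneg_left
        (mul_le_mul_of_nonneg_left (norm_fst_le (w - z)) zero_le_two) (norm_nonneg _)
    · exact mul_le_mul_of_nonneg_left
        (mul_le_mul_of_nonneg_left (norm_snd_le (w - z)) zero_le_two) (norm_nonneg _)
  obtain ⟨K, hK0, hK⟩ := key g hg
  obtain ⟨K', hK0', hK'⟩ := key g' hg'
  refine ⟨⟨max K K', le_max_of_le_left hK0⟩, fun t => LipschitzWith.of_dist_le_mul fun w z => ?_⟩
  rw [dist_eq_norm, dist_eq_norm]
  change _ ≤ max K K' * ‖w - z‖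
  refine max_le ((norm_kick_sub_le t _ _).trans ((hK t w z).trans ?_))
    ((norm_kick_sub_le t _ _).trans ((hK' t w z).trans ?_))
  · exact mul_le_mul_of_nonneg_right (le_max_left _ _) (norm_nonneg _)
  · exact mul_le_mul_of_nonneg_right (le_max_right _ _) (norm_nonneg _)

theorem exists_integralCurve_vectorField (ρ : Realization V lam ι B) (ρ' : Realization V' lam' ι' B')
    {g g' : ℝ → ℝ → ℝ} (hg : IsBddLip g) (hg' : IsBddLip g') (z : (L2 × L2) × (L2 × L2)) :
    ∃ w : ℝ → (L2 × L2) × (L2 × L2), w 0 = z ∧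
      ∀ t, HasDerivAt w (vectorField ρ ρ' hg hg' t (w t)) t := by
  obtain ⟨K, hK⟩ := exists_lipschitzWith_vectorField ρ ρ' hg hg'
  obtain ⟨M, hM0, hM⟩ := hg.exists_norm_op_le
  obtain ⟨M', hM0', hM'⟩ := hg'.exists_norm_op_le
  refine exists_global_integralCurve _ K ⟨max M M', le_max_of_le_left hM0⟩ hK (fun x => ?_)
    (fun t x => ?_) z
  · have h1 : Continuous fun t => ρ.pos t x.1 :=
      continuousOn_univ.1 (ρ.continuous_pos continuousOn_const)
    have h2 : Continuous fun t => ρ'.pos t x.2 :=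
      continuousOn_univ.1 (ρ'.continuous_pos continuousOn_const)
    exact (continuousOn_univ.1 (continuous_kick
        (hg.continuous_op.comp (h1.prodMk h2)).continuousOn)).prodMk
      (continuousOn_univ.1 (continuous_kick
        (hg'.continuous_op.comp (h1.prodMk h2)).continuousOn))
  · exact max_le ((norm_kick_le _ _).trans ((hM _ _).trans (le_max_left _ _)))
      ((norm_kick_le _ _).trans ((hM' _ _).trans (le_max_right _ _)))

/-- The energy of the state `w` at time `t`, in the interaction picture. -/
def energy (ρ : Realization V lam ι B) (ρ' : Realization V' lam' ι' B') (ℓ : ℝ) (h : ℝ → ℝ)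
    (t : ℝ) (w : (L2 × L2) × (L2 × L2)) : ℝ :=
  1 / 2 * (‖w.1.1‖ ^ 2 + ‖w.1.2‖ ^ 2) + ℓ ^ 2 / 6 * (‖w.2.1‖ ^ 2 + ‖w.2.2‖ ^ 2)
    + ∫ x, potential ℓ h (ρ.pos t w.1 x) (ρ'.pos t w.2 x) ∂μI

/-- Conservation of energy. -/
theorem energy_eq (ρ : Realization V lam ι B) (ρ' : Realization V' lam' ι' B') {ℓ : ℝ}
    (hℓ : 0 < ℓ) {h : ℝ → ℝ} (hh : IsTamed h) {w : ℝ → (L2 × L2) × (L2 × L2)}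
    (hw : ∀ t, HasDerivAt w
      (vectorField ρ ρ' (hh.isBddLip_force ℓ) (hh.isBddLip_torque ℓ (3 / ℓ)) t (w t)) t) (t : ℝ) :
    energy ρ ρ' ℓ h t (w t) = energy ρ ρ' ℓ h 0 (w 0) := by
  obtain ⟨C, hC0, hC⟩ := (hh.isBddLip_force ℓ).exists_taylor (hh.isBddLip_torque ℓ ℓ)
    (hh.hasDerivAt_potential ℓ)
  have hd : ∀ t, HasDerivAt (fun t => energy ρ ρ' ℓ h t (w t)) 0 t := by
    intro t
    have h1 := hasDerivAt_norm_sq_of_kick (hw t).fst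
    have h2 := hasDerivAt_norm_sq_of_kick (hw t).snd
    have h3 := hasDerivAt_integral_comp (hh.isBddLip_force ℓ) (hh.isBddLip_torque ℓ ℓ)
      (hh.integrable_potential ℓ) hC0 hC (ρ.hasDerivAt_pos (fun t => (hw t).fst) t)
      (ρ'.hasDerivAt_pos (fun t => (hw t).snd) t)
    refine (((h1.const_mul (1 / 2)).add (h2.const_mul (ℓ ^ 2 / 6))).add h3).congr_deriv ?_
    have e : ∀ u v β : L2, inner ℝ ((hh.isBddLip_torque ℓ ℓ).op u v) β
        = ℓ ^ 2 / 3 * inner ℝ ((hh.isBddLip_torque ℓ (3 / ℓ)).op u v) β := by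
      intro u v β
      rw [IsBddLip.inner_op, IsBddLip.inner_op, ← integral_const_mul]
      congr 1
      ext x
      field_simp
    rw [e]
    ring
  exact is_const_of_deriv_eq_zero (fun t => (hd t).differentiableAt) (fun t => (hd t).deriv) t 0

end Energy

/-! ### Comparison of the original and the truncated nonlinearities -/

section Truncation

variable {ℓ R : ℝ} {f : ℝ → ℝ}

theorem truncate_sin_eq (hℓ : 0 < ℓ) {a b : ℝ} (ha : |a| + ℓ ≤ R) :
    truncate f R (a - ℓ * Real.sin b) = f (a - ℓ * Real.sin b) ∧
      truncate f R (a + ℓ * Real.sin b) = f (a + ℓ * Real.sin b) := by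
  obtain ⟨h1, h2⟩ := abs_add_sin_le ℓ a b
  rw [abs_of_pos hℓ] at h1 h2
  exact ⟨truncate_of_abs_le f (h1.trans ha), truncate_of_abs_le f (h2.trans ha)⟩

/-- The truncation is inactive as long as `|u| + ℓ ≤ R`. -/
theorem integral_force_eq (hℓ : 0 < ℓ) (hh : IsTamed (truncate f R)) {u : L2}
    (hu : ∀ᵐ x ∂μI, |u x| + ℓ ≤ R) (v φ : L2) :
    ∫ x, (f (u x - ℓ * Real.sin (v x)) + f (u x + ℓ * Real.sin (v x))) * φ x ∂μI
      = inner ℝ ((hh.isBddLip_force ℓ).op u v) φ := by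
  rw [IsBddLip.inner_op]
  refine integral_congr_ae ?_
  filter_upwards [hu] with x hx
  obtain ⟨h1, h2⟩ := truncate_sin_eq (f := f) hℓ (b := v x) hx
  rw [force, h1, h2]

theorem integral_torque_eq (hℓ : 0 < ℓ) (hh : IsTamed (truncate f R)) {u : L2}
    (hu : ∀ᵐ x ∂μI, |u x| + ℓ ≤ R) (v φ : L2) :
    ∫ x, 3 * Real.cos (v x)
        * (f (u x + ℓ * Real.sin (v x)) - f (u x - ℓ * Real.sin (v x))) * φ x ∂μI
      = ℓ * inner ℝ ((hh.isBddLip_torque ℓ (3 / ℓ)).op u v) φ := by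
  rw [IsBddLip.inner_op, ← integral_const_mul]
  refine integral_congr_ae ?_
  filter_upwards [hu] with x hx
  obtain ⟨h1, h2⟩ := truncate_sin_eq (f := f) hℓ (b := v x) hx
  rw [torque, h1, h2]
  field_simp

theorem ae_abs_add_le (u : H2H10) {M : ℝ} (hM : ‖u‖ ≤ M) (hR : √Real.pi * M + ℓ ≤ R) :
    ∀ᵐ x ∂μI, |H2H10.toL2 u x| + ℓ ≤ R := by
  filter_upwards [H2H10.ae_abs_le u] with x hx
  have := mul_le_mul_of_nonneg_left hM (Real.sqrt_nonneg Real.pi)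
  linarith

end Truncation

/-! ### Existence -/

section Existence

/-- Potential energy of the initial data, bounded independently of the truncation. -/
theorem integral_potential_truncate_le {ℓ : ℝ} {f : ℝ → ℝ} {M r R : ℝ} (hR : 0 ≤ R)
    (hM : ∀ s ∈ Icc (-r) r, ‖f s‖ ≤ M) {u : L2} (hu : ∀ᵐ x ∂μI, |u x| + |ℓ| ≤ r) (v : L2) :
    ∫ x, potential ℓ (truncate f R) (u x) (v x) ∂μI ≤ 2 * |M| * r * μI.real univ := by
  refine (Real.le_norm_self _).trans (norm_integral_le_of_norm_le_const ?_)
  filter_upwards [hu] with x hx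
  have h1 : ∀ τ, |τ| ≤ |u x| + |ℓ| → |truncate f R τ| ≤ |M| := by
    intro τ hτ
    have hτ' := abs_le.1 (hτ.trans hx)
    refine (hM _ ⟨?_, ?_⟩).trans (le_abs_self M)
    · rcases le_total R τ with h | h
      · rw [min_eq_left h]
        exact le_max_of_le_right (by linarith [abs_nonneg τ])
      · rw [min_eq_right h]
        exact le_max_of_le_right hτ'.1
    · exact max_le (by linarith [abs_nonneg τ]) (min_le_of_right_le hτ'.2)
  refine (abs_potential_le (abs_nonneg M) h1).trans ?_
  exact mul_le_mul_of_nonneg_left hx (by positivity)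

/-- The truncation level `R` is chosen after the energy of the initial data, whose bound `E₀` holds
for every truncation of `f`. -/
theorem exists_solution {ℓ : ℝ} (hℓ : 0 < ℓ) {f : ℝ → ℝ} (hf_lip : LocallyLipschitz f)
    (hf_mono : Monotone f) (hf_zero : f 0 = 0) (η₀ : H2H10) (θ₀ : H10) (η₁ θ₁ : L2) :
    ∃ (y : ℝ → H2H10) (θ : ℝ → H10), IsSolution ℓ f η₀ η₁ θ₀ θ₁ y θ := by
  obtain ⟨ρ, hρ⟩ : ∃ ρ, ρ = realizationH2H10 := ⟨_, rfl⟩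
  obtain ⟨ρ', hρ'⟩ : ∃ ρ', ρ' = realizationH10 := ⟨_, rfl⟩
  set r := √Real.pi * ‖η₀‖ + ℓ with hr
  obtain ⟨M, hM⟩ := (isCompact_Icc (a := -r) (b := r)).exists_bound_of_continuousOn
    hf_lip.continuous.continuousOn
  set E₀ := 1 / 2 * (‖ρ.D η₀‖ ^ 2 + ‖η₁‖ ^ 2) + ℓ ^ 2 / 6 * (‖ρ'.D θ₀‖ ^ 2 + ‖θ₁‖ ^ 2)
    + 2 * |M| * r * μI.real univ with hE₀
  set R := √Real.pi * (‖ρ.P‖ * √(2 * E₀)) + ℓ with hR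
  have hR0 : 0 ≤ R := by positivity
  have hh : IsTamed (truncate f R) := isTamed_truncate hf_lip hf_mono hf_zero hR0
  obtain ⟨w, hw0, hw⟩ := exists_integralCurve_vectorField ρ ρ' (hh.isBddLip_force ℓ)
    (hh.isBddLip_torque ℓ (3 / ℓ)) ((ρ.D η₀, η₁), (ρ'.D θ₀, θ₁))
  have hw₁ : ∀ t, HasDerivAt (fun t => (w t).1) _ t := fun t => (hw t).fst
  have hw₂ : ∀ t, HasDerivAt (fun t => (w t).2) _ t := fun t => (hw t).snd
  set y : ℝ → H2H10 := fun t => ρ.P (rot _ t (w t).1).1 with hy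
  set θ : ℝ → H10 := fun t => ρ'.P (rot _ t (w t).2).1 with hθ
  have hy0 : y 0 = η₀ := by simp only [hy, hw0, rot_zero, ρ.P_D]
  have hθ0 : θ 0 = θ₀ := by simp only [hθ, hw0, rot_zero, ρ'.P_D]
  -- the energy bound, which makes the truncation inactive
  have hE : energy ρ ρ' ℓ (truncate f R) 0 (w 0) ≤ E₀ := by
    have e : ρ.pos 0 (w 0).1 = H2H10.toL2 η₀ := congrArg H2H10.toL2 hy0
    have hle := integral_potential_truncate_le hR0 hM
      (u := H2H10.toL2 η₀) (ℓ := ℓ) (by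
        rw [abs_of_pos hℓ]
        exact ae_abs_add_le η₀ le_rfl le_rfl) (ρ'.pos 0 (w 0).2)
    rw [energy, e, hw0] at *
    linarith
  have hynorm : ∀ t, ‖y t‖ ≤ ‖ρ.P‖ * √(2 * E₀) := by
    intro t
    refine (ρ.P.le_opNorm _).trans (mul_le_mul_of_nonneg_left ?_ ρ.P.opNorm_nonneg)
    refine Real.le_sqrt_of_sq_le ?_
    have h1 := energy_eq ρ ρ' hℓ hh hw t
    have h2 := norm_sq_rot (lam := fun n => (n + 1 : ℝ) ^ 2) t (w t).1
    have h3 : 0 ≤ ∫ x, potential ℓ (truncate f R) (ρ.pos t (w t).1 x) (ρ'.pos t (w t).2 x) ∂μI :=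
      integral_nonneg fun x => hh.potential_nonneg _ _ _
    have h4 : 0 ≤ ℓ ^ 2 / 6 * (‖(w t).2.1‖ ^ 2 + ‖(w t).2.2‖ ^ 2) := by positivity
    rw [energy] at h1
    have h5 := sq_nonneg ‖(rot (fun n => (n + 1 : ℝ) ^ 2) t (w t).1).2‖
    linarith
  have hae : ∀ t, ∀ᵐ x ∂μI, |H2H10.toL2 (y t) x| + ℓ ≤ R := fun t =>
    ae_abs_add_le (y t) (hynorm t) le_rfl
  have hwc₁ : Continuous fun t => (w t).1 :=
    continuous_iff_continuousAt.2 fun t => (hw₁ t).continuousAt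
  have hwc₂ : Continuous fun t => (w t).2 :=
    continuous_iff_continuousAt.2 fun t => (hw₂ t).continuousAt
  have hpos : Continuous fun t => (ρ.pos t (w t).1, ρ'.pos t (w t).2) :=
    (continuousOn_univ.1 (ρ.continuous_pos hwc₁.continuousOn)).prodMk
      (continuousOn_univ.1 (ρ'.continuous_pos hwc₂.continuousOn))
  obtain ⟨hy1, hy2, hyeq⟩ := ρ.weak_solution_of_kick
    ((hh.isBddLip_force ℓ).continuous_op.comp hpos) hw₁
  obtain ⟨hθ1, hθ2, hθeq⟩ := ρ'.weak_solution_of_kick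
    ((hh.isBddLip_torque ℓ (3 / ℓ)).continuous_op.comp hpos) hw₂
  refine ⟨y, θ, ?_⟩
  exact
    { y_C0 := (ρ.P.continuous.comp_continuousOn (continuous_rot hwc₁.continuousOn).fst)
      y_C1 := hy1.contDiffOn
      y_C2 := hy2.contDiffOn
      θ_C0 := (ρ'.P.continuous.comp_continuousOn (continuous_rot hwc₂.continuousOn).fst)
      θ_C1 := hθ1.contDiffOn
      θ_C2 := hθ2.contDiffOn
      y_init := hy0
      yt_init := by
        refine ((ρ.hasDerivAt_pos hw₁ 0).hasDerivWithinAt.derivWithin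
          (uniqueDiffOn_Ici 0 0 self_mem_Ici)).trans ?_
        rw [rot_zero, hw0]
      θ_init := hθ0
      θt_init := by
        refine ((ρ'.hasDerivAt_pos hw₂ 0).hasDerivWithinAt.derivWithin
          (uniqueDiffOn_Ici 0 0 self_mem_Ici)).trans ?_
        rw [rot_zero, hw0]
      eq_y := fun t ht φ => by
        rw [integral_force_eq hℓ hh (hae t)]
        exact hyeq t ht.le φ
      eq_θ := fun t ht ψ => by
        rw [integral_torque_eq hℓ hh (hae t), ← mul_add, ← mul_add]
        exact mul_eq_zero_of_right _ (hθeq t ht.le ψ) }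

end Existence

/-! ### Uniqueness -/

section Uniqueness

variable {V : Type*} [NormedAddCommGroup V] [NormedSpace ℝ V] {lam : ℕ → ℝ} {ι B : V →L[ℝ] L2}

/-- The state `(a, b)` at time `t` transported back to time `0` by the free evolution. -/
def rotBack (lam : ℕ → ℝ) (t : ℝ) (z : L2 × L2) : L2 × L2 :=
  (cosOp lam t z.1 - sinOp lam t z.2, sinOp lam t z.1 + cosOp lam t z.2)

theorem rotBack_zero (z : L2 × L2) : rotBack lam 0 z = z := by
  simp [rotBack, cosOp_zero, sinOp_zero]

theorem rot_rotBack (t : ℝ) (z : L2 × L2) : rot lam t (rotBack lam t z) = z := by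
  refine Prod.ext (ext_sineL fun n => ?_) (ext_sineL fun n => ?_)
  · simp only [rot, rotBack, inner_add_right, inner_sub_right, inner_cosOp, inner_sinOp]
    linear_combination inner ℝ (sineL n) z.1 * Real.cos_sq_add_sin_sq (lam n * t)
  · simp only [rot, rotBack, inner_add_right, inner_sub_right, inner_cosOp, inner_sinOp]
    linear_combination inner ℝ (sineL n) z.2 * Real.cos_sq_add_sin_sq (lam n * t)

theorem Realization.ι_P_sineL (ρ : Realization V lam ι B) (n : ℕ) :
    ι (ρ.P (sineL n)) = (lam n)⁻¹ • sineL n := by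
  refine ext_sineL fun j => ?_
  rw [ρ.inner_P, real_inner_smul_right, orthonormal_iff_ite.1 orthonormal_sineL j n]
  split_ifs with hjn
  · rw [hjn]
  · simp

/-- Tested against the sines, a weak solution of `u_tt + Λ² u + g = 0` solves the equation of the
interaction picture. -/
theorem Realization.kick_of_weak_solution (ρ : Realization V lam ι B) {u : ℝ → V} {g : ℝ → L2}
    (hu : ContinuousOn u (Ici 0)) (hg : ContinuousOn g (Ici 0))
    (hC1 : ContDiffOn ℝ 1 (fun t => ι (u t)) (Ici 0))
    (hC2 : ContDiffOn ℝ 2 (fun t => dualMap ι (ι (u t))) (Ici 0)) {T : ℝ}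
    (heq : ∀ t ∈ Ioo 0 T, ∀ φ : V,
      iteratedDerivWithin 2 (fun s => dualMap ι (ι (u s))) (Ici 0) t φ
        + inner ℝ (B (u t)) (B φ) + inner ℝ (g t) (ι φ) = 0) :
    ContinuousOn (fun t => rotBack lam t
      (ρ.D (u t), derivWithin (fun t => ι (u t)) (Ici 0) t)) (Ici 0) ∧
    ∀ t ∈ Ico 0 T, HasDerivWithinAt (fun t => rotBack lam t
      (ρ.D (u t), derivWithin (fun t => ι (u t)) (Ici 0) t)) (kick lam t (g t)) (Ici t) t := by
  set b : ℝ → L2 := derivWithin (fun t => ι (u t)) (Ici 0) with hb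
  have hbc : ContinuousOn b (Ici 0) :=
    hC1.continuousOn_derivWithin (uniqueDiffOn_Ici 0) le_rfl
  have hac : ContinuousOn (fun t => ρ.D (u t)) (Ici 0) := ρ.D.continuous.comp_continuousOn hu
  have hud : ∀ t, 0 ≤ t → HasDerivWithinAt (fun t => ι (u t)) (b t) (Ici 0) t := fun t ht =>
    (hC1.differentiableOn one_ne_zero t ht).hasDerivWithinAt
  -- the equations satisfied by the coordinates of `(Λ u, u_t)`
  have ha' : ∀ n, ∀ t ∈ Ioo 0 T, HasDerivAt (fun s => inner ℝ (sineL n) (ρ.D (u s)))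
      (lam n * inner ℝ (sineL n) (b t)) t := by
    intro n t ht
    simp only [ρ.inner_D]
    exact (hasDerivAt_inner ((hud t ht.1.le).hasDerivAt (Ici_mem_nhds ht.1)) _).const_mul _
  have hb' : ∀ n, ∀ t ∈ Ioo 0 T, HasDerivAt (fun s => inner ℝ (sineL n) (b s))
      (-(lam n * inner ℝ (sineL n) (ρ.D (u t))) - inner ℝ (sineL n) (g t)) t := by
    intro n t ht
    have hn := ρ.lam_ne_zero n
    have h1 : ∀ s, 0 ≤ s →
        derivWithin (fun t => dualMap ι (ι (u t))) (Ici 0) s = dualMap ι (b s) := fun s hs =>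
      ((dualMap ι).hasFDerivAt.comp_hasDerivWithinAt s (hud s hs)).derivWithin
        (uniqueDiffOn_Ici 0 s hs)
    have h2 : HasDerivAt (fun s => dualMap ι (b s))
        (iteratedDerivWithin 2 (fun s => dualMap ι (ι (u s))) (Ici 0) t) t := by
      have hd := hC2.differentiableOn_iteratedDerivWithin (m := 1) (by norm_num)
        (uniqueDiffOn_Ici 0) t ht.1.le
      have h3 := hd.hasDerivWithinAt.hasDerivAt (Ici_mem_nhds ht.1)
      rw [← iteratedDerivWithin_succ] at h3
      refine h3.congr_of_eventuallyEq ?_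
      filter_upwards [Ici_mem_nhds ht.1] with s hs
      rw [iteratedDerivWithin_one, h1 s hs]
    have h3 := ((ContinuousLinearMap.apply ℝ ℝ (ρ.P (sineL n))).hasFDerivAt.comp_hasDerivAt t
      h2).const_mul (lam n)
    have h4 := heq t ht (ρ.P (sineL n))
    rw [real_inner_comm, ρ.inner_B_P, ρ.ι_P_sineL, real_inner_smul_right,
      real_inner_comm (sineL n) (g t)] at h4
    refine (h3.congr_of_eventuallyEq (Filter.Eventually.of_forall fun s => ?_)).congr_deriv ?_
    · change _ = lam n * inner ℝ (b s) (ι (ρ.P (sineL n)))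
      rw [ρ.ι_P_sineL, real_inner_smul_right, mul_inv_cancel_left₀ hn, real_inner_comm]
    · change lam n * (iteratedDerivWithin 2 (fun s => dualMap ι (ι (u s))) (Ici 0) t
        (ρ.P (sineL n))) = _
      rw [eq_sub_of_add_eq (eq_neg_of_add_eq_zero_left h4)]
      field_simp
      ring
  have hcont : ContinuousOn (fun t => rotBack lam t (ρ.D (u t), b t)) (Ici 0) :=
    ((continuousOn_cosOp hac).sub (continuousOn_sinOp hbc)).prodMk
      ((continuousOn_sinOp hac).add (continuousOn_cosOp hbc))
  have hk := continuous_kick (lam := lam) hg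
  refine ⟨hcont, fun t ht => ?_⟩
  refine HasDerivWithinAt.prodMk
    (hasDerivWithinAt_of_coord sineBasis hk.fst (fun n => ?_) (fun n s hs => ?_) ht)
    (hasDerivWithinAt_of_coord sineBasis hk.snd (fun n => ?_) (fun n s hs => ?_) ht)
  · exact (innerSL ℝ (sineBasis n)).continuous.comp_continuousOn hcont.fst
  · have h1 := ((hasDerivAt_cos_mul (lam n) s).mul (ha' n s hs)).sub
      ((hasDerivAt_sin_mul (lam n) s).mul (hb' n s hs))
    simp only [coe_sineBasis, inner_sub_right, inner_cosOp, inner_sinOp]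
    refine h1.congr_deriv ?_
    simp only [kick, inner_sinOp]
    ring
  · exact (innerSL ℝ (sineBasis n)).continuous.comp_continuousOn hcont.snd
  · have h1 := ((hasDerivAt_sin_mul (lam n) s).mul (ha' n s hs)).add
      ((hasDerivAt_cos_mul (lam n) s).mul (hb' n s hs))
    simp only [coe_sineBasis, inner_add_right, inner_cosOp, inner_sinOp]
    refine h1.congr_deriv ?_
    simp only [kick, inner_neg_right, inner_cosOp]
    ring

/-- A solution of the fish-bone system whose first component is bounded on `[0, T]` follows the
vector field of the truncated problem. -/
theorem IsSolution.hasDerivWithinAt_rotBack {ℓ : ℝ} (hℓ : 0 < ℓ) {f : ℝ → ℝ} {η₀ : H2H10}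
    {θ₀ : H10} {η₁ θ₁ : L2} {y : ℝ → H2H10} {θ : ℝ → H10}
    (hs : IsSolution ℓ f η₀ η₁ θ₀ θ₁ y θ) {R T : ℝ} (hh : IsTamed (truncate f R))
    (hR : ∀ t ∈ Icc 0 T, ∀ᵐ x ∂μI, |H2H10.toL2 (y t) x| + ℓ ≤ R) :
    ∃ w : ℝ → (L2 × L2) × (L2 × L2),
      w 0 = ((realizationH2H10.D η₀, η₁), (realizationH10.D θ₀, θ₁)) ∧
      (∀ t, y t = realizationH2H10.P (rot (fun n => (n + 1 : ℝ) ^ 2) t (w t).1).1) ∧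
      (∀ t, θ t = realizationH10.P (rot (fun n => (n + 1 : ℝ)) t (w t).2).1) ∧
      ContinuousOn w (Ici 0) ∧
      ∀ t ∈ Ico 0 T, HasDerivWithinAt w (vectorField realizationH2H10 realizationH10
        (hh.isBddLip_force ℓ) (hh.isBddLip_torque ℓ (3 / ℓ)) t (w t)) (Ici t) t := by
  obtain ⟨ρ, hρ⟩ : ∃ ρ, ρ = realizationH2H10 := ⟨_, rfl⟩
  obtain ⟨ρ', hρ'⟩ : ∃ ρ', ρ' = realizationH10 := ⟨_, rfl⟩
  rw [← hρ, ← hρ']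
  have hpos : ContinuousOn (fun t => (H2H10.toL2 (y t), H10.toL2 (θ t))) (Ici 0) :=
    (H2H10.toL2.continuous.comp_continuousOn hs.y_C0).prodMk
      (H10.toL2.continuous.comp_continuousOn hs.θ_C0)
  obtain ⟨hc₁, hw₁⟩ := ρ.kick_of_weak_solution (T := T) hs.y_C0
    ((hh.isBddLip_force ℓ).continuous_op.comp_continuousOn hpos) hs.y_C1 hs.y_C2
    (fun t ht φ => by
      have h := hs.eq_y t ht.1 φ
      rw [integral_force_eq hℓ hh (hR t ⟨ht.1.le, ht.2.le⟩)] at h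
      exact h)
  obtain ⟨hc₂, hw₂⟩ := ρ'.kick_of_weak_solution (T := T) hs.θ_C0
    ((hh.isBddLip_torque ℓ (3 / ℓ)).continuous_op.comp_continuousOn hpos) hs.θ_C1 hs.θ_C2
    (fun t ht φ => by
      have h := hs.eq_θ t ht.1 φ
      rw [integral_torque_eq hℓ hh (hR t ⟨ht.1.le, ht.2.le⟩), ← mul_add, ← mul_add] at h
      exact (mul_eq_zero.1 h).resolve_left hℓ.ne')
  refine ⟨fun t => (rotBack _ t (ρ.D (y t), derivWithin (fun t => H2H10.toL2 (y t)) (Ici 0) t),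
    rotBack _ t (ρ'.D (θ t), derivWithin (fun t => H10.toL2 (θ t)) (Ici 0) t)),
    ?_, fun t => ?_, fun t => ?_, hc₁.prodMk hc₂, fun t ht => ?_⟩
  · simp only [rotBack_zero, hs.y_init, hs.yt_init, hs.θ_init, hs.θt_init]
  · simp only [rot_rotBack, ρ.P_D]
  · simp only [rot_rotBack, ρ'.P_D]
  · have h := (hw₁ t ht).prodMk (hw₂ t ht)
    simp only [vectorField, Realization.pos, rot_rotBack, ρ.P_D, ρ'.P_D]
    exact h

theorem IsSolution.unique {ℓ : ℝ} (hℓ : 0 < ℓ) {f : ℝ → ℝ} (hf_lip : LocallyLipschitz f)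
    (hf_mono : Monotone f) (hf_zero : f 0 = 0) {η₀ : H2H10} {θ₀ : H10} {η₁ θ₁ : L2}
    {y y' : ℝ → H2H10} {θ θ' : ℝ → H10} (hs : IsSolution ℓ f η₀ η₁ θ₀ θ₁ y θ)
    (hs' : IsSolution ℓ f η₀ η₁ θ₀ θ₁ y' θ') : EqOn y y' (Ici 0) ∧ EqOn θ θ' (Ici 0) := by
  suffices h : ∀ T, 0 ≤ T → y T = y' T ∧ θ T = θ' T from
    ⟨fun T hT => (h T hT).1, fun T hT => (h T hT).2⟩
  intro T hT
  obtain ⟨M, hM⟩ := (isCompact_Icc (a := 0) (b := T)).exists_bound_of_continuousOn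
    (hs.y_C0.mono Icc_subset_Ici_self)
  obtain ⟨M', hM'⟩ := (isCompact_Icc (a := 0) (b := T)).exists_bound_of_continuousOn
    (hs'.y_C0.mono Icc_subset_Ici_self)
  have hM0 : 0 ≤ max M M' :=
    le_max_of_le_left ((norm_nonneg _).trans (hM 0 (left_mem_Icc.2 hT)))
  have hh : IsTamed (truncate f (√Real.pi * max M M' + ℓ)) :=
    isTamed_truncate hf_lip hf_mono hf_zero (by positivity)
  obtain ⟨w, hw0, hwy, hwθ, hwc, hw⟩ := hs.hasDerivWithinAt_rotBack hℓ hh fun t ht =>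
    ae_abs_add_le (y t) ((hM t ht).trans (le_max_left _ _)) le_rfl
  obtain ⟨w', hw0', hwy', hwθ', hwc', hw'⟩ := hs'.hasDerivWithinAt_rotBack hℓ hh fun t ht =>
    ae_abs_add_le (y' t) ((hM' t ht).trans (le_max_right _ _)) le_rfl
  obtain ⟨K, hK⟩ := exists_lipschitzWith_vectorField realizationH2H10 realizationH10
    (hh.isBddLip_force ℓ) (hh.isBddLip_torque ℓ (3 / ℓ))
  have h := ODE_solution_unique hK (hwc.mono Icc_subset_Ici_self) hw
    (hwc'.mono Icc_subset_Ici_self) hw' (hw0.trans hw0'.symm) (right_mem_Icc.2 hT)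
  rw [hwy, hwθ, hwy', hwθ', h]
  exact ⟨rfl, rfl⟩

end Uniqueness

end FishBone

end

theorem theorem2p1 (ℓ : ℝ) (hℓ : 0 < ℓ)
    (f : ℝ → ℝ) (hf_lip : LocallyLipschitz f) (hf_mono : Monotone f) (hf_zero : f 0 = 0)
    (C p : ℝ) (hp : 1 ≤ p) (hf_growth : ∀ s : ℝ, s ≠ 0 → |f s| ≤ C * (1 + |s| ^ p))
    (η₀ : FishBone.H2H10) (θ₀ : FishBone.H10) (η₁ θ₁ : FishBone.L2) :
    (∃ (y : ℝ → FishBone.H2H10) (θ : ℝ → FishBone.H10),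
      FishBone.IsSolution ℓ f η₀ η₁ θ₀ θ₁ y θ) ∧
    (∀ (y y' : ℝ → FishBone.H2H10) (θ θ' : ℝ → FishBone.H10),
      FishBone.IsSolution ℓ f η₀ η₁ θ₀ θ₁ y θ → FishBone.IsSolution ℓ f η₀ η₁ θ₀ θ₁ y' θ' →
        EqOn y y' (Ici 0) ∧ EqOn θ θ' (Ici 0)) :=
  ⟨FishBone.exists_solution hℓ hf_lip hf_mono hf_zero η₀ θ₀ η₁ θ₁,
    fun _ _ _ _ hs hs' => hs.unique hℓ hf_lip hf_mono hf_zero hs'⟩
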